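/- Let $k$ be a field and let $\Lambda$ and $\Gamma$ be symmetric $k$-algebras, that is, finite-dimensional $k$-algebras with $\Lambda\cong\operatorname{Hom}_k(\Lambda,k)$ as $(\Lambda,\Lambda)$-bimodules and $\Gamma\cong\operatorname{Hom}_k(\Gamma,k)$ as $(\Gamma,\Gamma)$-bimodules. Let $M$ be a $(\Lambda,\Gamma)$-bimodule on which $k$ acts centrally, and suppose that $M$ induces a separable equivalence between $\Lambda$ and $\Gamma$: there is a $(\Gamma,\Lambda)$-bimodule $N$ such that $M$ and $N$ are finitely generated projective as left modules and as right modules, and there are a $(\Lambda,\Lambda)$-bimodule $X$, a $(\Gamma,\Gamma)$-bimodule $Y$ and isomorphisms of bimodules $$M\otimes_\Gamma N\cong\Lambda\oplus X,\qquad N\otimes_\Lambda M\cong\Gamma\oplus Y.$$ Let $M^*=\operatorname{Hom}_\Lambda(M,\Lambda)$ (left $\Lambda$-linear maps), regarded as a $(\Gamma,\Lambda)$-bimodule. Let $U$ be a finitely generated left $\Lambda$-module and $V$ a finitely generated left $\Gamma$-module such that $$M^*\otimes_\Lambda U\in\operatorname{add}V\quad\text{and}\quad M\otimes_\Gamma V\in\operatorname{add}U,$$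 where $\operatorname{add}W$ is the class of modules isomorphic to a direct summand of $W^n$ for some $n\ge 0$. Then $$\operatorname{dom.dim}\operatorname{End}_\Lambda U=\operatorname{dom.dim}\operatorname{End}_\Gamma V .$$ Here endomorphism algebras are multiplied by composition of maps, and the dominant dimension of a ring $A$ is the least $n\ge 0$ such that the term $I^n$ of the minimal injective coresolution $0\to A\to I^0\to I^1\to\cdots$ of the left $A$-module $A$ is not projective, and $\infty$ if every $I^n$ is projective. -/

import Mathlib

open MulOpposite
open scoped TensorProduct

/-! Right modules over a ring `R` are modules over `Rᵐᵒᵖ`, with `m * r = op r • m`.  An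
`(R, S)`-bimodule is an abelian group with a left `R`- and a right `S`-module structure which
commute (`SMulCommClass R Sᵐᵒᵖ M`). -/

universe u v w

noncomputable section

/-! ### Tensor products over a noncommutative ring -/

section BalancedTensor

/-- The subgroup of `M ⊗[ℤ] N` generated by all `m * g ⊗ n - m ⊗ g * n`. -/
def balancedRelations (Γ : Type w) [Ring Γ] (M : Type u) (N : Type v)
    [AddCommGroup M] [Module Γᵐᵒᵖ M] [AddCommGroup N] [Module Γ N] :
    AddSubgroup (M ⊗[ℤ] N) :=
  AddSubgroup.closure
    {t | ∃ (m : M) (g : Γ) (n : N), t = (op g • m) ⊗ₜ[ℤ] n - m ⊗ₜ[ℤ] (g • n)}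

/-- The tensor product `M ⊗_Γ N` of a right `Γ`-module `M` and a left `Γ`-module `N` over an
arbitrary ring `Γ`. -/
def BalancedTensor (Γ : Type w) [Ring Γ] (M : Type u) (N : Type v)
    [AddCommGroup M] [Module Γᵐᵒᵖ M] [AddCommGroup N] [Module Γ N] : Type (max u v) :=
  (M ⊗[ℤ] N) ⧸ balancedRelations Γ M N

namespace BalancedTensor

variable (Γ : Type w) [Ring Γ] (M : Type u) (N : Type v)
  [AddCommGroup M] [Module Γᵐᵒᵖ M] [AddCommGroup N] [Module Γ N]

instance instAddCommGroup : AddCommGroup (BalancedTensor Γ M N) :=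
  inferInstanceAs (AddCommGroup ((M ⊗[ℤ] N) ⧸ balancedRelations Γ M N))

variable {M N}

/-- The elementary tensor `m ⊗ n` in `M ⊗_Γ N`. -/
def tmul (m : M) (n : N) : BalancedTensor Γ M N :=
  QuotientAddGroup.mk' (balancedRelations Γ M N) (m ⊗ₜ[ℤ] n)

variable {Γ}

theorem smul_tmul (m : M) (g : Γ) (n : N) : tmul Γ (op g • m) n = tmul Γ m (g • n) :=
  (QuotientAddGroup.eq_iff_sub_mem).2 (AddSubgroup.subset_closure ⟨m, g, n, rfl⟩)

theorem tmul_add (m : M) (n n' : N) : tmul Γ m (n + n') = tmul Γ m n + tmul Γ m n' :=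
  (congrArg (QuotientAddGroup.mk' _) (TensorProduct.tmul_add m n n')).trans (map_add _ _ _)

theorem add_tmul (m m' : M) (n : N) : tmul Γ (m + m') n = tmul Γ m n + tmul Γ m' n :=
  (congrArg (QuotientAddGroup.mk' _) (TensorProduct.add_tmul m m' n)).trans (map_add _ _ _)

theorem zero_tmul (n : N) : tmul Γ (0 : M) n = 0 :=
  (congrArg (QuotientAddGroup.mk' _) (TensorProduct.zero_tmul M n)).trans (map_zero _)

theorem tmul_zero (m : M) : tmul Γ m (0 : N) = 0 :=
  (congrArg (QuotientAddGroup.mk' _) (TensorProduct.tmul_zero N m)).trans (map_zero _)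

theorem induction_on {p : BalancedTensor Γ M N → Prop} (t : BalancedTensor Γ M N)
    (zero : p 0) (tmul : ∀ m n, p (tmul Γ m n)) (add : ∀ x y, p x → p y → p (x + y)) : p t := by
  obtain ⟨t, rfl⟩ := QuotientAddGroup.mk'_surjective (balancedRelations Γ M N) t
  induction t using TensorProduct.induction_on with
  | zero => rw [map_zero]; exact zero
  | tmul m n => exact tmul m n
  | add x y hx hy => rw [map_add]; exact add _ _ hx hy

theorem hom_ext {P : Type*} [AddCommGroup P] {f g : BalancedTensor Γ M N →+ P}
    (h : ∀ m n, f (tmul Γ m n) = g (tmul Γ m n)) : f = g := by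
  ext t
  induction t using induction_on with
  | zero => simp
  | tmul m n => exact h m n
  | add x y hx hy => rw [map_add, map_add, hx, hy]

/-- The universal property: a biadditive map `f` with `f (m * g) n = f m (g * n)` factors through
`M ⊗_Γ N`. -/
def lift {P : Type*} [AddCommGroup P] (f : M →+ N →+ P)
    (hf : ∀ (m : M) (g : Γ) (n : N), f (op g • m) n = f m (g • n)) :
    BalancedTensor Γ M N →+ P :=
  QuotientAddGroup.lift (balancedRelations Γ M N)
    (TensorProduct.liftAddHom f fun r m n => by rw [map_zsmul, map_zsmul]; rfl) (by
      refine (AddSubgroup.closure_le _).2 ?_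
      rintro _ ⟨m, g, n, rfl⟩
      change TensorProduct.liftAddHom f _ _ = 0
      rw [map_sub, TensorProduct.liftAddHom_tmul, TensorProduct.liftAddHom_tmul, hf, sub_self])

@[simp] theorem lift_tmul {P : Type*} [AddCommGroup P] (f : M →+ N →+ P)
    (hf : ∀ (m : M) (g : Γ) (n : N), f (op g • m) n = f m (g • n)) (m : M) (n : N) :
    lift f hf (tmul Γ m n) = f m n := rfl

variable {M' : Type*} {N' : Type*} [AddCommGroup M'] [Module Γᵐᵒᵖ M'] [AddCommGroup N']
  [Module Γ N']

/-- The map `f ⊗ g : M ⊗_Γ N → M' ⊗_Γ N'` of two linear maps. -/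
def map (f : M →ₗ[Γᵐᵒᵖ] M') (g : N →ₗ[Γ] N') : BalancedTensor Γ M N →+ BalancedTensor Γ M' N' :=
  lift (AddMonoidHom.mk' (fun m => AddMonoidHom.mk' (fun n => tmul Γ (f m) (g n))
      fun n n' => by rw [map_add, tmul_add])
      fun m m' => by ext n; simp [add_tmul])
    fun m c n => by simp [smul_tmul]

@[simp] theorem map_tmul (f : M →ₗ[Γᵐᵒᵖ] M') (g : N →ₗ[Γ] N') (m : M) (n : N) :
    map f g (tmul Γ m n) = tmul Γ (f m) (g n) := rfl

/-- The left action `r * (m ⊗ n) = r * m ⊗ n` on `M ⊗_Γ N`, for an `(R, Γ)`-bimodule `M`. -/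
instance instModuleLeft {R : Type*} [Ring R] [Module R M] [SMulCommClass R Γᵐᵒᵖ M] :
    Module R (BalancedTensor Γ M N) where
  smul r t := map (Module.toModuleEnd Γᵐᵒᵖ (S := R) M r) LinearMap.id t
  one_smul t := DFunLike.congr_fun (g := AddMonoidHom.id _)
    (hom_ext fun m n => congrArg (tmul Γ · n) (one_smul R m)) t
  mul_smul r s t := DFunLike.congr_fun (g := (map _ _).comp (map _ _))
    (hom_ext fun m n => congrArg (tmul Γ · n) (mul_smul r s m)) t
  smul_zero _ := map_zero _
  smul_add _ := map_add _
  add_smul r s t := DFunLike.congr_fun (g := map _ _ + map _ _)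
    (hom_ext fun m n => (congrArg (tmul Γ · n) (add_smul r s m)).trans (add_tmul _ _ _)) t
  zero_smul t := DFunLike.congr_fun (g := 0)
    (hom_ext fun m n => (congrArg (tmul Γ · n) (zero_smul R m)).trans (zero_tmul n)) t

/-- The right action `(m ⊗ n) * s = m ⊗ n * s` on `M ⊗_Γ N`, for a `(Γ, S)`-bimodule `N`. -/
instance instModuleRight {S : Type*} [Ring S] [Module Sᵐᵒᵖ N] [SMulCommClass Γ Sᵐᵒᵖ N] :
    Module Sᵐᵒᵖ (BalancedTensor Γ M N) :=
  haveI : SMulCommClass Sᵐᵒᵖ Γ N := SMulCommClass.symm _ _ _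
  { smul := fun s t => map LinearMap.id (Module.toModuleEnd Γ (S := Sᵐᵒᵖ) N s) t
    one_smul := fun t => DFunLike.congr_fun (g := AddMonoidHom.id _)
      (hom_ext fun m n => congrArg (tmul Γ m) (one_smul Sᵐᵒᵖ n)) t
    mul_smul := fun r s t => DFunLike.congr_fun (g := (map _ _).comp (map _ _))
      (hom_ext fun m n => congrArg (tmul Γ m) (mul_smul r s n)) t
    smul_zero := fun _ => map_zero _
    smul_add := fun _ => map_add _
    add_smul := fun r s t => DFunLike.congr_fun (g := map _ _ + map _ _)
      (hom_ext fun m n => (congrArg (tmul Γ m) (add_smul r s n)).trans (tmul_add _ _ _)) t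
    zero_smul := fun t => DFunLike.congr_fun (g := 0)
      (hom_ext fun m n => (congrArg (tmul Γ m) (zero_smul Sᵐᵒᵖ n)).trans (tmul_zero m)) t }

theorem left_smul_tmul {R : Type*} [Ring R] [Module R M] [SMulCommClass R Γᵐᵒᵖ M]
    (r : R) (m : M) (n : N) : r • tmul Γ m n = tmul Γ (r • m) n := rfl

theorem right_smul_tmul {S : Type*} [Ring S] [Module Sᵐᵒᵖ N] [SMulCommClass Γ Sᵐᵒᵖ N]
    (s : S) (m : M) (n : N) : op s • tmul Γ m n = tmul Γ m (op s • n) := rfl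

end BalancedTensor

end BalancedTensor

/-! ### The dual of a bimodule -/

section BimoduleDual

/-- `M^* = Hom_Λ(M, Λ)`, the left `Λ`-linear maps from `M` to `Λ`. -/
def BimoduleDual (Λ : Type u) [Ring Λ] (M : Type v) [AddCommGroup M] [Module Λ M] :
    Type (max u v) :=
  M →ₗ[Λ] Λ

namespace BimoduleDual

variable (Λ : Type u) [Ring Λ] (M : Type v) [AddCommGroup M] [Module Λ M]

instance instAddCommGroup : AddCommGroup (BimoduleDual Λ M) :=
  inferInstanceAs (AddCommGroup (M →ₗ[Λ] Λ))

instance instFunLike : FunLike (BimoduleDual Λ M) M Λ :=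
  inferInstanceAs (FunLike (M →ₗ[Λ] Λ) M Λ)

/-- The right `Λ`-action `(f * a)(m) = f(m) * a`. -/
instance instModuleRight : Module Λᵐᵒᵖ (BimoduleDual Λ M) :=
  inferInstanceAs (Module Λᵐᵒᵖ (M →ₗ[Λ] Λ))

variable {Γ : Type w} [Ring Γ] [Module Γᵐᵒᵖ M] [SMulCommClass Λ Γᵐᵒᵖ M]

/-- The left `Γ`-action `(g * f)(m) = f(m * g)`, for a `(Λ, Γ)`-bimodule `M`. -/
instance instModuleLeft : Module Γ (BimoduleDual Λ M) where
  smul g f := LinearMap.comp (show M →ₗ[Λ] Λ from f)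
    ({ toFun := fun m => op g • m
       map_add' := smul_add _
       map_smul' := fun a m => (smul_comm a (op g) m).symm } : M →ₗ[Λ] M)
  one_smul f := LinearMap.ext fun m => congrArg (show M →ₗ[Λ] Λ from f) (one_smul Γᵐᵒᵖ m)
  mul_smul g h f := LinearMap.ext fun m =>
    congrArg (show M →ₗ[Λ] Λ from f) (mul_smul (op h) (op g) m)
  smul_zero _ := LinearMap.ext fun _ => rfl
  smul_add _ _ _ := LinearMap.ext fun _ => rfl
  add_smul g h f := LinearMap.ext fun m =>
    (congrArg (show M →ₗ[Λ] Λ from f) (add_smul (op g) (op h) m)).trans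
      ((show M →ₗ[Λ] Λ from f).map_add _ _)
  zero_smul f := LinearMap.ext fun m =>
    (congrArg (show M →ₗ[Λ] Λ from f) (zero_smul Γᵐᵒᵖ m)).trans
      ((show M →ₗ[Λ] Λ from f).map_zero)

theorem right_smul_apply (a : Λ) (f : BimoduleDual Λ M) (m : M) : (op a • f) m = f m * a := rfl

theorem left_smul_apply (g : Γ) (f : BimoduleDual Λ M) (m : M) : (g • f) m = f (op g • m) := rfl

instance instSMulCommClass : SMulCommClass Γ Λᵐᵒᵖ (BimoduleDual Λ M) :=
  ⟨fun _ _ _ => LinearMap.ext fun _ => rfl⟩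

end BimoduleDual

end BimoduleDual

/-! ### Symmetric algebras, separable equivalences, `add U` -/

/-- A finite-dimensional algebra `Λ` over a field `k` is symmetric if `Λ` and `Hom_k(Λ, k)` are
isomorphic as `(Λ, Λ)`-bimodules, where `(a * f * b)(y) = f(b * y * a)` on `Hom_k(Λ, k)`. -/
def IsSymmetricFrobeniusAlgebra (k : Type u) [Field k] (Λ : Type v) [Ring Λ] [Algebra k Λ] : Prop :=
  FiniteDimensional k Λ ∧
    ∃ e : Λ ≃ₗ[k] Module.Dual k Λ, ∀ a x b y : Λ, e (a * x * b) y = e x (b * y * a)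

/-- For a `(Λ, Λ)`-bimodule `T`: there are a `(Λ, Λ)`-bimodule `X` and an isomorphism of
bimodules `T ≅ Λ ⊕ X`. -/
def SplitsOffRegularBimodule (Λ : Type u) [Ring Λ] (T : Type v) [AddCommGroup T]
    [Module Λ T] [Module Λᵐᵒᵖ T] : Prop :=
  ∃ (X : Type v) (_ : AddCommGroup X) (_ : Module Λ X) (_ : Module Λᵐᵒᵖ X)
    (_ : SMulCommClass Λ Λᵐᵒᵖ X) (e : T ≃ₗ[Λ] Λ × X),
    ∀ (a : Λ) (t : T), e (op a • t) = op a • e t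

/-- The rings `Λ` and `Γ` are separably equivalent, induced by the bimodules `_Λ M_Γ` and
`_Γ N_Λ`: both are finitely generated projective on each side, `M ⊗_Γ N ≅ Λ ⊕ X` as
`(Λ, Λ)`-bimodules and `N ⊗_Λ M ≅ Γ ⊕ Y` as `(Γ, Γ)`-bimodules. -/
structure IsSeparableEquivalence (Λ : Type*) [Ring Λ] (Γ : Type*) [Ring Γ]
    (M : Type*) [AddCommGroup M] [Module Λ M] [Module Γᵐᵒᵖ M] [SMulCommClass Λ Γᵐᵒᵖ M]
    (N : Type*) [AddCommGroup N] [Module Γ N] [Module Λᵐᵒᵖ N] [SMulCommClass Γ Λᵐᵒᵖ N] :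
    Prop where
  finite_M_left : Module.Finite Λ M
  projective_M_left : Module.Projective Λ M
  finite_M_right : Module.Finite Γᵐᵒᵖ M
  projective_M_right : Module.Projective Γᵐᵒᵖ M
  finite_N_left : Module.Finite Γ N
  projective_N_left : Module.Projective Γ N
  finite_N_right : Module.Finite Λᵐᵒᵖ N
  projective_N_right : Module.Projective Λᵐᵒᵖ N
  split_left : SplitsOffRegularBimodule Λ (BalancedTensor Γ M N)
  split_right : SplitsOffRegularBimodule Γ (BalancedTensor Λ N M)

/-- `W ∈ add U`: `W` is isomorphic to a direct summand of `U ^ n` for some `n`. -/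
def IsInAdd (R : Type*) [Ring R] (W : Type v) [AddCommGroup W] [Module R W]
    (U : Type u) [AddCommGroup U] [Module R U] : Prop :=
  ∃ (n : ℕ) (W' : Type u) (_ : AddCommGroup W') (_ : Module R W'),
    Nonempty ((W × W') ≃ₗ[R] (Fin n → U))

/-! ### Dominant dimension -/

/-- A minimal injective coresolution `0 → X → I 0 → I 1 → ⋯` of a left `A`-module `X`: an exact
sequence with all `I n` injective, in which the image of the map into each `I n`, which equals
the kernel of `d n`, is an essential submodule of `I n`. -/
structure MinimalInjectiveCoresolution (A : Type u) [Ring A] (X : Type u) [AddCommGroup X]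
    [Module A X] where
  I : ℕ → Type u
  [addCommGroup : ∀ n, AddCommGroup (I n)]
  [module : ∀ n, Module A (I n)]
  injective : ∀ n, Module.Injective A (I n)
  ε : X →ₗ[A] I 0
  d : ∀ n, I n →ₗ[A] I (n + 1)
  ε_injective : Function.Injective ε
  exact_zero : Function.Exact ε (d 0)
  exact_succ : ∀ n, Function.Exact (d n) (d (n + 1))
  essential : ∀ (n : ℕ) (S : Submodule A (I n)), S ⊓ LinearMap.ker (d n) = ⊥ → S = ⊥

attribute [instance] MinimalInjectiveCoresolution.addCommGroup MinimalInjectiveCoresolution.module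

/-- The dominant dimension of a ring `A`: the least `n` such that the term `I n` of the minimal
injective coresolution of the left module `A` is not projective, and `⊤` if every term is
projective.  (The minimal injective coresolution exists and is unique up to isomorphism.) -/
def dominantDimension (A : Type u) [Ring A] : ℕ∞ :=
  sInf {d : ℕ∞ | ∃ (C : MinimalInjectiveCoresolution A A) (n : ℕ),
    ¬ Module.Projective A (C.I n) ∧ d = n}

end

noncomputable section

/-! ### Injective hulls and minimal injective coresolutions -/

section Injective

/-! Put `A = End_Λ(U)`, `B = End_Γ(V)`, `W = M ⊗_Γ V`, and let `Q = Hom_Λ(W, U)`, an `(A,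
B)`-bimodule. The functor `Hom_A(Q, -)` compares coresolutions over `A` and `B`. If `Q` is finitely
generated projective on both sides, it is exact and preserves injectives (`TwistedHom.baer`). If
moreover `Hom_A(Q, A)` is projective over `B`, it preserves projectives (`TwistedHom.projective`).
If finally `B` is a retract of a power of `Hom_A(Q, A)`, then the minimal coresolution of `B` is
termwise a retract of a power of the image of that of `A` (`exists_retract`). So projective terms
over `A` force projective terms over `B`, and `dom.dim A ≤ dom.dim B`.

These conditions come from biadjointness. Over symmetric algebras `M^*` is dual to `M` on both sides
(`exists_biadjointPair`), so `Q ≅ Hom_Γ(V, M^* ⊗ U)` and `Hom_A(Q, A) ≅ Hom_Λ(U, W) ≅ Hom_Γ(M^* ⊗ U,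
V)`; both are projective over `B` because `M^* ⊗ U ∈ add V`, while `W ∈ add U` handles `Q` over `A`.
Since `Γ` splits off `N ⊗_Λ M`, the counit `M^* ⊗ (M ⊗ V) → V` splits (`exists_section`), so `V ∈
add(M^* ⊗ U)`, which makes `B` a retract of a power of `Hom_Γ(M^* ⊗ U, V)`. The data are symmetric
in `Λ` and `Γ`, so the reverse inequality follows likewise. -/

theorem Module.Baer.of_retract {R : Type*} [Ring R] {J E : Type*} [AddCommGroup J] [Module R J]
    [AddCommGroup E] [Module R E] (hJ : Module.Baer R J) (i : E →ₗ[R] J) (r : J →ₗ[R] E)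
    (hri : ∀ x, r (i x) = x) : Module.Baer R E := fun I g => by
  obtain ⟨g', hg'⟩ := hJ I (i ∘ₗ g)
  exact ⟨r ∘ₗ g', fun x hx => by simp [hg' x hx, hri]⟩

theorem Module.Baer.pi {R : Type*} [Ring R] {ι : Type*} {J : ι → Type*}
    [∀ i, AddCommGroup (J i)] [∀ i, Module R (J i)] (hJ : ∀ i, Module.Baer R (J i)) :
    Module.Baer R (∀ i, J i) := fun I g => by
  choose g' hg' using fun i => hJ i I (LinearMap.proj i ∘ₗ g)
  exact ⟨LinearMap.pi g', fun x hx => funext fun i => by simp [hg' i x hx]⟩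

/-- Injectivity is carried as `Module.Baer` because `Module.Injective` tests only modules in one
universe, while `Hom_A(Q, T)` may live in another. -/
theorem Module.Baer.exists_comp_eq {R : Type*} [Ring R] {J X Y : Type*} [AddCommGroup J]
    [Module R J] [AddCommGroup X] [Module R X] [AddCommGroup Y] [Module R Y]
    (hJ : Module.Baer R J) (f : X →ₗ[R] Y) (g : X →ₗ[R] J)
    (hfg : LinearMap.ker f ≤ LinearMap.ker g) : ∃ h : Y →ₗ[R] J, ∀ x, h (f x) = g x := by
  obtain ⟨h, hh⟩ := hJ.extension_property ((LinearMap.ker f).liftQ f le_rfl)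
    (LinearMap.ker_eq_bot.1 (Submodule.ker_liftQ_eq_bot' _ _ rfl)) ((LinearMap.ker f).liftQ g hfg)
  exact ⟨h, fun x => DFunLike.congr_fun hh ((LinearMap.ker f).mkQ x)⟩

theorem exists_maximal_essential_extension {R : Type*} [Ring R] {J : Type*} [AddCommGroup J]
    [Module R J] (K : Submodule R J) :
    ∃ E : Submodule R J, Maximal (fun E => K ≤ E ∧ ∀ T ≤ E, T ⊓ K = ⊥ → T = ⊥) E := by
  suffices h : ∀ c ⊆ {E : Submodule R J | K ≤ E ∧ ∀ T ≤ E, T ⊓ K = ⊥ → T = ⊥},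
      IsChain (· ≤ ·) c → ∀ y ∈ c,
        ∃ ub ∈ {E : Submodule R J | K ≤ E ∧ ∀ T ≤ E, T ⊓ K = ⊥ → T = ⊥}, ∀ z ∈ c, z ≤ ub by
    obtain ⟨E, -, hE⟩ := zorn_le_nonempty₀ _ h K
      ⟨le_rfl, fun T hT h => by rwa [inf_eq_left.2 hT] at h⟩
    exact ⟨E, hE⟩
  intro c hc hchain y hy
  refine ⟨sSup c, ⟨(hc hy).1.trans (le_sSup hy), fun T hT h => ?_⟩, fun z hz => le_sSup hz⟩
  refine (Submodule.eq_bot_iff _).2 fun x hx => ?_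
  obtain ⟨E, hEc, hxE⟩ := (Submodule.mem_sSup_of_directed ⟨y, hy⟩ hchain.directedOn).1 (hT hx)
  -- Essentiality is tested on cyclic submodules: one generated by an element of the union already
  -- lies in a member of the chain.
  have := (hc hEc).2 (Submodule.span R {x}) (by simpa using hxE)
    (eq_bot_iff.2 <| (inf_le_inf_right K (by simpa using hx)).trans h.le)
  simpa using this

theorem exists_maximal_disjoint {R : Type*} [Ring R] {J : Type*} [AddCommGroup J]
    [Module R J] (E : Submodule R J) :
    ∃ S : Submodule R J, Maximal (fun S => E ⊓ S = ⊥) S := by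
  suffices h : ∀ c ⊆ {S : Submodule R J | E ⊓ S = ⊥}, IsChain (· ≤ ·) c → ∀ y ∈ c,
      ∃ ub ∈ {S : Submodule R J | E ⊓ S = ⊥}, ∀ z ∈ c, z ≤ ub by
    obtain ⟨S, -, hS⟩ := zorn_le_nonempty₀ _ h ⊥ (by simp)
    exact ⟨S, hS⟩
  intro c hc hchain y hy
  refine ⟨sSup c, (Submodule.eq_bot_iff _).2 fun x hx => ?_, fun z hz => le_sSup hz⟩
  obtain ⟨S, hSc, hxS⟩ := (Submodule.mem_sSup_of_directed ⟨y, hy⟩ hchain.directedOn).1 hx.2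
  exact (Submodule.eq_bot_iff _).1 (hc hSc) x ⟨hx.1, hxS⟩

/-- Inside an injective `J ⊇ X`, a maximal essential extension `E` of `X` is a direct summand. With
`S` a maximal submodule disjoint from `E`, the inclusion `E → J` extends along `E → J/S` to `h`; the
image of `J → J/S → J` contains `E` and is still essential over `X`, so it equals `E`. -/
theorem exists_injective_hull (R : Type u) [Ring R] (X : Type u) [AddCommGroup X] [Module R X] :
    ∃ (E : Type u) (_ : AddCommGroup E) (_ : Module R E) (ι : X →ₗ[R] E),
      Module.Injective R E ∧ Function.Injective ι ∧
        ∀ S : Submodule R E, S ⊓ LinearMap.range ι = ⊥ → S = ⊥ := by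
  obtain ⟨⟨J', hJ', j', hj'⟩⟩ :=
    CategoryTheory.EnoughInjectives.presentation (ModuleCat.of R X)
  let J : Type u := J'
  let j : X →ₗ[R] J := j'.hom
  have hj : Function.Injective j := (ModuleCat.mono_iff_injective j').1 hj'
  have hJ : Module.Baer R J :=
    Module.Baer.of_injective (Module.injective_module_of_injective_object R J)
  obtain ⟨E, ⟨hKE, hE⟩, hmax⟩ := exists_maximal_essential_extension (LinearMap.range j)
  obtain ⟨S, hES, hS⟩ := exists_maximal_disjoint E
  obtain ⟨h, hh⟩ := hJ.exists_comp_eq (S.mkQ ∘ₗ E.subtype) E.subtype (fun x hx => by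
    have hx' : (x : J) ∈ S := by simpa using hx
    have : (x : J) ∈ E ⊓ S := ⟨x.2, hx'⟩
    rw [hES] at this
    simpa using this)
  have hh' : ∀ y ∈ E, h (S.mkQ y) = y := fun y hy => hh ⟨y, hy⟩
  -- The preimage of `T` contains `S` and is disjoint from `E`, so maximality of `S` applies.
  have key : ∀ T : Submodule R J, T ⊓ E = ⊥ → T.comap (h ∘ₗ S.mkQ) ≤ S := fun T hT => by
    refine hS ((Submodule.eq_bot_iff _).2 fun y hy => ?_) fun x hx => ?_
    · refine (Submodule.eq_bot_iff _).1 hT y ⟨?_, hy.1⟩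
      have h1 : h (S.mkQ y) ∈ T := hy.2
      rwa [hh' y hy.1] at h1
    · rw [Submodule.mem_comap, LinearMap.comp_apply, Submodule.mkQ_apply,
        (Submodule.Quotient.mk_eq_zero S).2 hx, map_zero]
      exact zero_mem _
  have hrange : LinearMap.range (h ∘ₗ S.mkQ) ≤ E := by
    refine hmax ⟨fun x hx => ⟨x, hh' x (hKE hx)⟩, fun T hT hTK => ?_⟩
      fun x hx => ⟨x, hh' x hx⟩
    have hTE : T ⊓ E = ⊥ := hE _ inf_le_right
      (eq_bot_iff.2 ((inf_le_inf_right _ inf_le_left).trans hTK.le))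
    refine (Submodule.eq_bot_iff _).2 fun x hx => ?_
    obtain ⟨z, rfl⟩ := hT hx
    rw [LinearMap.comp_apply, Submodule.mkQ_apply,
      (Submodule.Quotient.mk_eq_zero S).2 (key T hTE hx), map_zero]
  refine ⟨E, inferInstance, inferInstance,
    j.codRestrict E fun x => hKE ⟨x, rfl⟩, ?_, fun x y hxy => hj (congrArg Subtype.val hxy), ?_⟩
  · refine (hJ.of_retract E.subtype
      ((h ∘ₗ S.mkQ).codRestrict E fun x => hrange ⟨x, rfl⟩) fun x => ?_).injective
    exact Subtype.ext (hh' x x.2)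
  · intro T hT
    have := hE (T.map E.subtype) (Submodule.map_subtype_le E T) (by
      refine (Submodule.eq_bot_iff _).2 ?_
      rintro _ ⟨⟨x, hx, rfl⟩, y, hy⟩
      exact congrArg Subtype.val ((Submodule.eq_bot_iff _).1 hT x ⟨hx, y, Subtype.ext hy⟩))
    exact (Submodule.eq_bot_iff _).2 fun x hx =>
      Subtype.ext ((Submodule.eq_bot_iff _).1 this x ⟨x, hx, rfl⟩)

/-- An injective hull of a module. -/
def InjectiveHull (R : Type u) [Ring R] (X : Type u) [AddCommGroup X] [Module R X] : Type u :=
  (exists_injective_hull R X).choose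

namespace InjectiveHull

variable (R : Type u) [Ring R] (X : Type u) [AddCommGroup X] [Module R X]

instance : AddCommGroup (InjectiveHull R X) := (exists_injective_hull R X).choose_spec.choose

instance : Module R (InjectiveHull R X) := (exists_injective_hull R X).choose_spec.choose_spec.choose

/-- The embedding of a module into its injective hull. -/
def ι : X →ₗ[R] InjectiveHull R X :=
  (exists_injective_hull R X).choose_spec.choose_spec.choose_spec.choose

theorem injective : Module.Injective R (InjectiveHull R X) :=
  (exists_injective_hull R X).choose_spec.choose_spec.choose_spec.choose_spec.1

theorem ι_injective : Function.Injective (ι R X) :=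
  (exists_injective_hull R X).choose_spec.choose_spec.choose_spec.choose_spec.2.1

theorem essential (S : Submodule R (InjectiveHull R X)) (hS : S ⊓ LinearMap.range (ι R X) = ⊥) :
    S = ⊥ :=
  (exists_injective_hull R X).choose_spec.choose_spec.choose_spec.choose_spec.2.2 S hS

/-- The cosyzygies of a module. -/
def cosyzygy (n : ℕ) : ModuleCat.{u} R :=
  n.rec (ModuleCat.of R X) fun _ K =>
    ModuleCat.of R (InjectiveHull R K ⧸ LinearMap.range (ι R K))

/-- A module is its own zeroth cosyzygy. -/
def cosyzygyZero : X ≃ₗ[R] cosyzygy R X 0 := LinearEquiv.refl R X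

/-- The projection of the injective hull of a cosyzygy to the next cosyzygy. -/
def π (n : ℕ) : InjectiveHull R (cosyzygy R X n) →ₗ[R] cosyzygy R X (n + 1) :=
  (LinearMap.range (ι R (cosyzygy R X n))).mkQ

theorem ker_π (n : ℕ) : LinearMap.ker (π R X n) = LinearMap.range (ι R (cosyzygy R X n)) :=
  Submodule.ker_mkQ _

theorem range_π (n : ℕ) : LinearMap.range (π R X n) = ⊤ :=
  Submodule.range_mkQ _

theorem ker_ι : LinearMap.ker (ι R X) = ⊥ := LinearMap.ker_eq_bot.2 (ι_injective R X)

/-- The minimal injective coresolution built from injective hulls. -/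
def minimalCoresolution : MinimalInjectiveCoresolution R X where
  I n := InjectiveHull R (cosyzygy R X n)
  injective n := injective R _
  ε := ι R (cosyzygy R X 0) ∘ₗ (cosyzygyZero R X).toLinearMap
  d n := ι R (cosyzygy R X (n + 1)) ∘ₗ π R X n
  ε_injective := (ι_injective R _).comp (cosyzygyZero R X).injective
  exact_zero := by
    rw [LinearMap.exact_iff, LinearMap.ker_comp, ker_ι, ← LinearMap.ker, ker_π,
      LinearMap.range_comp, LinearEquiv.range, Submodule.map_top]
  exact_succ n := by
    rw [LinearMap.exact_iff, LinearMap.ker_comp, ker_ι, ← LinearMap.ker, ker_π,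
      LinearMap.range_comp, range_π, Submodule.map_top]
  essential n S hS := essential R _ S (by
    rwa [LinearMap.ker_comp, ker_ι, ← LinearMap.ker, ker_π] at hS)

end InjectiveHull

/-- A minimal injective coresolution of a retract `X` of a module `Y` is degreewise a retract of any
injective coresolution of `Y`. -/
theorem MinimalInjectiveCoresolution.exists_retract {B : Type u} [Ring B] {X : Type u}
    [AddCommGroup X] [Module B X] (C : MinimalInjectiveCoresolution B X)
    {Y : Type*} [AddCommGroup Y] [Module B Y] (J : ℕ → Type*) [∀ n, AddCommGroup (J n)]
    [∀ n, Module B (J n)] (hJ : ∀ n, Module.Baer B (J n)) (ε : Y →ₗ[B] J 0)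
    (d : ∀ n, J n →ₗ[B] J (n + 1)) (hε : Function.Injective ε) (h0 : Function.Exact ε (d 0))
    (hd : ∀ n, Function.Exact (d n) (d (n + 1))) (i : X →ₗ[B] Y) (r : Y →ₗ[B] X)
    (hri : ∀ x, r (i x) = x) (n : ℕ) :
    ∃ (a : C.I n →ₗ[B] J n) (b : J n →ₗ[B] C.I n), ∀ x, b (a x) = x := by
  have hC : ∀ n, Module.Baer B (C.I n) := fun n => Module.Baer.of_injective (C.injective n)
  -- An endomorphism that is bijective on the essential submodule `ker d` is bijective: it is
  -- injective, so has a left inverse `ρ`, and `ρ` is in turn injective because `ψ` maps `ker d`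
  -- onto itself.
  have bij : ∀ (n : ℕ) (ψ : C.I n →ₗ[B] C.I n), (∀ x, C.d n x = 0 → ψ x = 0 → x = 0) →
      (∀ x, C.d n x = 0 → ∃ y, C.d n y = 0 ∧ ψ y = x) → Function.Bijective ψ := by
    intro n ψ hinj hsurj
    have hψ : LinearMap.ker ψ = ⊥ := C.essential n _
      ((Submodule.eq_bot_iff _).2 fun x hx => hinj x hx.2 hx.1)
    obtain ⟨ρ, hρ⟩ := (hC n).exists_comp_eq ψ LinearMap.id (by simp [hψ])
    have hker : LinearMap.ker ρ = ⊥ := C.essential n _ ((Submodule.eq_bot_iff _).2 fun x hx => by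
      obtain ⟨y, -, rfl⟩ := hsurj x hx.2
      have h1 : ρ (ψ y) = 0 := hx.1
      rw [hρ] at h1
      rw [show y = 0 from h1, map_zero])
    refine ⟨LinearMap.ker_eq_bot.1 hψ, fun x => ⟨ρ x, LinearMap.ker_eq_bot.1 hker (hρ _)⟩⟩
  -- Extensions to the next degree are not unique, so `b ∘ a` need not stay the identity; what
  -- survives the induction is that it is bijective on `ker d`. The last lines correct `b` by the
  -- inverse.
  have main : ∃ (a : C.I n →ₗ[B] J n) (b : J n →ₗ[B] C.I n),
      (∀ x, C.d n x = 0 → d n (a x) = 0) ∧ (∀ y, d n y = 0 → C.d n (b y) = 0) ∧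
      (∀ x, C.d n x = 0 → b (a x) = 0 → x = 0) ∧
      (∀ x, C.d n x = 0 → ∃ y, C.d n y = 0 ∧ b (a y) = x) := by
    induction n with
    | zero =>
      obtain ⟨a, ha⟩ := (hJ 0).exists_comp_eq C.ε (ε ∘ₗ i)
        (by simp [LinearMap.ker_eq_bot.2 C.ε_injective])
      obtain ⟨b, hb⟩ := (hC 0).exists_comp_eq ε (C.ε ∘ₗ r) (by simp [LinearMap.ker_eq_bot.2 hε])
      have hba : ∀ x, C.d 0 x = 0 → b (a x) = x := fun x hx => by
        obtain ⟨x, rfl⟩ := (C.exact_zero x).1 hx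
        rw [ha, LinearMap.comp_apply, hb, LinearMap.comp_apply, hri]
      refine ⟨a, b, fun x hx => ?_, fun y hy => ?_, fun x hx h => ?_, fun x hx => ⟨x, hx, hba x hx⟩⟩
      · obtain ⟨x, rfl⟩ := (C.exact_zero x).1 hx
        rw [ha]
        exact h0.apply_apply_eq_zero _
      · obtain ⟨y, rfl⟩ := (h0 y).1 hy
        rw [hb]
        exact C.exact_zero.apply_apply_eq_zero _
      · rwa [hba x hx] at h
    | succ n ih =>
      obtain ⟨a, b, ha, hb, hinj, hsurj⟩ := ih
      obtain ⟨hψi, hψs⟩ := bij n (b ∘ₗ a) hinj hsurj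
      obtain ⟨a', ha'⟩ := (hJ (n + 1)).exists_comp_eq (C.d n) (d n ∘ₗ a) (fun x hx => ha x hx)
      obtain ⟨b', hb'⟩ := (hC (n + 1)).exists_comp_eq (d n) (C.d n ∘ₗ b) (fun x hx => hb x hx)
      refine ⟨a', b', fun x hx => ?_, fun y hy => ?_, fun x hx h => ?_, fun x hx => ?_⟩
      · obtain ⟨x, rfl⟩ := (C.exact_succ n x).1 hx
        rw [ha']
        exact (hd n).apply_apply_eq_zero _
      · obtain ⟨y, rfl⟩ := (hd n y).1 hy
        rw [hb']
        exact (C.exact_succ n).apply_apply_eq_zero _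
      · obtain ⟨x, rfl⟩ := (C.exact_succ n x).1 hx
        rw [ha', LinearMap.comp_apply, hb', LinearMap.comp_apply] at h
        obtain ⟨z, hz, hzx⟩ := hsurj _ h
        rwa [← hψi hzx]
      · obtain ⟨x, rfl⟩ := (C.exact_succ n x).1 hx
        obtain ⟨z, rfl⟩ := hψs x
        refine ⟨C.d n z, (C.exact_succ n).apply_apply_eq_zero _, ?_⟩
        rw [ha', LinearMap.comp_apply, hb']
        rfl
  obtain ⟨a, b, -, -, hinj, hsurj⟩ := main
  obtain ⟨hψi, hψs⟩ := bij n (b ∘ₗ a) hinj hsurj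
  obtain ⟨ρ, hρ⟩ := (hC n).exists_comp_eq (b ∘ₗ a) LinearMap.id
    (by simp [LinearMap.ker_eq_bot.2 hψi])
  exact ⟨a, ρ ∘ₗ b, hρ⟩

end Injective

/-! ### Projectivity and exactness of powers -/

theorem Module.Projective.finsupp (R ι P : Type*) [Ring R] [AddCommGroup P] [Module R P]
    [Module.Projective R P] : Module.Projective R (ι →₀ P) := by
  classical
  exact Module.Projective.of_equiv' (finsuppLequivDFinsupp R (M := P)).symm

theorem Module.Projective.pi_of_finite (R ι P : Type*) [Finite ι] [Ring R] [AddCommGroup P]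
    [Module R P] [Module.Projective R P] : Module.Projective R (ι → P) :=
  have := Module.Projective.finsupp R ι P
  Module.Projective.of_equiv' (Finsupp.linearEquivFunOnFinite R P ι)

theorem LinearMap.exact_compLeft {R X Y Z : Type*} [Ring R] [AddCommGroup X] [Module R X]
    [AddCommGroup Y] [Module R Y] [AddCommGroup Z] [Module R Z] {f : X →ₗ[R] Y} {g : Y →ₗ[R] Z}
    (h : Function.Exact f g) (ι : Type*) : Function.Exact (f.compLeft ι) (g.compLeft ι) := by
  intro y
  constructor
  · intro hy
    choose x hx using fun i => (h (y i)).1 (congrFun hy i)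
    exact ⟨x, funext hx⟩
  · rintro ⟨x, rfl⟩
    exact funext fun i => h.apply_apply_eq_zero _

/-! ### The functor `Hom_A(Q, -)` for an `(A, B)`-bimodule `Q` -/

/-- `Hom_A(Q, T)` as a left `B`-module, where the right action of `B` on the left `A`-module `Q` is
given by a ring homomorphism `ρ`. -/
def TwistedHom {A B Q : Type*} [Ring A] [Ring B] [AddCommGroup Q] [Module A Q]
    (_ρ : Bᵐᵒᵖ →+* Module.End A Q) (T : Type*) [AddCommGroup T] [Module A T] : Type _ :=
  Q →ₗ[A] T

namespace TwistedHom

variable {A B Q : Type*} [Ring A] [Ring B] [AddCommGroup Q] [Module A Q]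
  (ρ : Bᵐᵒᵖ →+* Module.End A Q) {T T' T'' : Type*} [AddCommGroup T] [Module A T]
  [AddCommGroup T'] [Module A T'] [AddCommGroup T''] [Module A T'']

instance : AddCommGroup (TwistedHom ρ T) := inferInstanceAs (AddCommGroup (Q →ₗ[A] T))

instance : FunLike (TwistedHom ρ T) Q T := inferInstanceAs (FunLike (Q →ₗ[A] T) Q T)

instance : LinearMapClass (TwistedHom ρ T) A Q T :=
  inferInstanceAs (LinearMapClass (Q →ₗ[A] T) A Q T)

/-- A linear map, as an element of `TwistedHom ρ T`. -/
def of (u : Q →ₗ[A] T) : TwistedHom ρ T := u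

variable {ρ}

/-- An element of `TwistedHom ρ T`, as a linear map. -/
def toLinearMap (u : TwistedHom ρ T) : Q →ₗ[A] T := u

@[simp] theorem of_apply (u : Q →ₗ[A] T) (q : Q) : of ρ u q = u q := rfl

@[ext] theorem ext {u u' : TwistedHom ρ T} (h : ∀ q, u q = u' q) : u = u' := LinearMap.ext h

@[simp] theorem add_apply (u u' : TwistedHom ρ T) (q : Q) : (u + u') q = u q + u' q := rfl

theorem sum_apply {ι : Type*} (s : Finset ι) (u : ι → TwistedHom ρ T) (q : Q) :
    (∑ i ∈ s, u i) q = ∑ i ∈ s, u i q :=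
  LinearMap.sum_apply s (fun i => (u i).toLinearMap) q

instance : Module B (TwistedHom ρ T) where
  smul b u := of ρ (u.toLinearMap ∘ₗ ρ (op b))
  one_smul u := ext fun q => congrArg u (DFunLike.congr_fun (map_one ρ) q)
  mul_smul b c u := ext fun q => congrArg u (DFunLike.congr_fun (map_mul ρ (op c) (op b)) q)
  smul_zero _ := rfl
  smul_add _ _ _ := rfl
  add_smul b c u := ext fun q =>
    (congrArg u (DFunLike.congr_fun (map_add ρ (op b) (op c)) q)).trans (map_add u _ _)
  zero_smul u := ext fun q =>
    (congrArg u (DFunLike.congr_fun (map_zero ρ) q)).trans (map_zero u)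

@[simp] theorem smul_apply (b : B) (u : TwistedHom ρ T) (q : Q) : (b • u) q = u (ρ (op b) q) := rfl

variable (ρ)

/-- Functoriality of `TwistedHom ρ T` in `T`. -/
def map (g : T →ₗ[A] T') : TwistedHom ρ T →ₗ[B] TwistedHom ρ T' where
  toFun u := of ρ (g ∘ₗ u.toLinearMap)
  map_add' _ _ := ext fun _ => map_add g _ _
  map_smul' _ _ := rfl

theorem map_injective {g : T →ₗ[A] T'} (hg : Function.Injective g) :
    Function.Injective (map ρ g) := fun _ _ h =>
  ext fun q => hg (DFunLike.congr_fun h q)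

theorem map_exact [Module.Projective A Q] {g : T →ₗ[A] T'} {h : T' →ₗ[A] T''}
    (hgh : Function.Exact g h) : Function.Exact (map ρ g) (map ρ h) := by
  intro u
  constructor
  · intro hu
    have hu' : ∀ q, u q ∈ LinearMap.range g := fun q => (hgh _).1 (DFunLike.congr_fun hu q)
    obtain ⟨w, hw⟩ := Module.projective_lifting_property g.rangeRestrict
      (u.toLinearMap.codRestrict _ hu') g.surjective_rangeRestrict
    exact ⟨of ρ w, ext fun q => congrArg Subtype.val (DFunLike.congr_fun hw q)⟩
  · rintro ⟨w, rfl⟩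
    exact ext fun q => hgh.apply_apply_eq_zero _

/-- `x` and `f` are a dual basis of `Q` as a right `B`-module, so `Q ⊗_B -` is exact and its right
adjoint `Hom_A(Q, -)` preserves injectives. The proof applies the adjunction to a left ideal `I`. -/
theorem baer {n : ℕ} (x : Fin n → Q) (f : Fin n → Q →+ B)
    (hf : ∀ i b q, f i (ρ (op b) q) = f i q * b) (hx : ∀ q, ∑ i, ρ (op (f i q)) (x i) = q)
    (hT : Module.Baer A T) : Module.Baer B (TwistedHom ρ T) := by
  intro I g
  have hfa : ∀ i (a : A) q, f i (a • q) = ∑ k, f i (a • x k) * f k q := fun i a q => by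
    conv_lhs => rw [← hx q, Finset.smul_sum, map_sum]
    simp only [← map_smul, hf]
  -- This is `Q I ≅ Q ⊗_B I`; `hfa` shows that it is stable under `A`.
  let S : Submodule A Q :=
    { carrier := {q | ∀ i, f i q ∈ I}
      add_mem' := fun hp hq i => by rw [map_add]; exact add_mem (hp i) (hq i)
      zero_mem' := fun i => by rw [map_zero]; exact zero_mem _
      smul_mem' := fun a q hq i => by
        rw [hfa]
        exact sum_mem fun k _ => I.mul_mem_left _ (hq k) }
  have hgb : ∀ (b : B) (j : I) (q : Q), g (b • j) q = g j (ρ (op b) q) := fun b j q => by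
    rw [map_smul, smul_apply]
  -- The adjoint of `g`: `q = ∑ x_i f_i(q)` goes to `∑ g(f_i(q))(x_i)`.
  let g' : S →ₗ[A] T :=
    { toFun := fun q => ∑ i, g ⟨f i q, q.2 i⟩ (x i)
      map_add' := fun p q => by
        rw [← Finset.sum_add_distrib]
        refine Finset.sum_congr rfl fun i _ => ?_
        rw [← add_apply, ← map_add]
        congr 2
        exact Subtype.ext (map_add _ _ _)
      map_smul' := fun a q => by
        have h1 : ∀ i, g ⟨f i (a • q : S), (a • q).2 i⟩ (x i)
            = ∑ k, g ⟨f k q, q.2 k⟩ (ρ (op (f i (a • x k))) (x i)) := fun i => by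
          simp only [← hgb, ← sum_apply, ← map_sum]
          congr 2
          refine Subtype.ext ?_
          rw [AddSubmonoidClass.coe_finsetSum]
          exact hfa i a q
        simp only [h1]
        rw [Finset.sum_comm, RingHom.id_apply, Finset.smul_sum]
        refine Finset.sum_congr rfl fun k _ => ?_
        rw [← map_sum, hx, map_smul] }
  obtain ⟨h, hh⟩ := hT.extension_property S.subtype S.injective_subtype g'
  refine ⟨LinearMap.toSpanSingleton B _ (of ρ h), fun b hb => ext fun q => ?_⟩
  rw [LinearMap.toSpanSingleton_apply, smul_apply, of_apply]
  have hq : ρ (op b) q ∈ S := fun i => by rw [hf]; exact I.mul_mem_left _ hb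
  refine (DFunLike.congr_fun hh ⟨_, hq⟩).trans ?_
  change ∑ i, g ⟨f i (ρ (op b) q), hq i⟩ (x i) = _
  have h1 : ∀ i, g ⟨f i (ρ (op b) q), hq i⟩ (x i) = g ⟨b, hb⟩ (ρ (op (f i q)) (x i)) := fun i => by
    rw [← hgb]
    congr 2
    exact Subtype.ext (hf i b q)
  simp only [h1]
  rw [← map_sum, hx]

/-- A section embeds `T` as a retract of a free module, possibly of infinite rank. As `Q` is
finitely generated, each map from `Q` to `T` has only finitely many nonzero coordinates, so
`Hom_A(Q, T)` is a retract of a direct sum of copies of `Hom_A(Q, A)`. -/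
theorem projective [Module.Finite A Q] [Module.Projective B (TwistedHom ρ A)]
    [hT : Module.Projective A T] : Module.Projective B (TwistedHom ρ T) := by
  obtain ⟨c, hc⟩ := Module.projective_def'.1 hT
  let coord (t : T) : T →ₗ[A] A := Finsupp.lapply t ∘ₗ c
  obtain ⟨s, hs⟩ := Module.Finite.fg_top (R := A) (M := Q)
  have hfin (u : TwistedHom ρ T) : (Function.support fun t => map ρ (coord t) u).Finite := by
    classical
    refine (s.biUnion fun q => (c (u q)).support).finite_toSet.subset fun t ht => ?_
    by_contra h
    refine ht ((LinearMap.ext_on (s := s) hs fun q hq => ?_ :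
      (map ρ (coord t) u).toLinearMap = 0))
    by_contra h'
    exact h (by
      simp only [Finset.coe_biUnion, Set.mem_iUnion]
      exact ⟨q, hq, Finset.mem_coe.2 (Finsupp.mem_support_iff.2 h')⟩)
  let σ : TwistedHom ρ T →ₗ[B] (T →₀ TwistedHom ρ A) :=
    { toFun := fun u => Finsupp.ofSupportFinite _ (hfin u)
      map_add' := fun u u' => Finsupp.ext fun t => map_add (map ρ (coord t)) u u'
      map_smul' := fun b u => Finsupp.ext fun t => map_smul (map ρ (coord t)) b u }
  have := Module.Projective.finsupp B T (TwistedHom ρ A)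
  refine Module.Projective.of_split σ
    (Finsupp.lsum ℕ fun t => map ρ (LinearMap.toSpanSingleton A T t)) ?_
  refine LinearMap.ext fun u => ext fun q => ?_
  rw [LinearMap.comp_apply, Finsupp.lsum_apply, Finsupp.sum, sum_apply]
  refine Eq.trans ?_ (DFunLike.congr_fun hc (u q))
  rw [LinearMap.comp_apply, Finsupp.linearCombination_apply,
    Finsupp.sum_of_support_subset _ (s := (σ u).support) ?_ _ (by simp)]
  · rfl
  · intro t ht
    rw [Finsupp.mem_support_iff] at ht ⊢
    exact fun h => ht (DFunLike.congr_fun h q)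

end TwistedHom

/-- Comparison of dominant dimensions along the exact functor `Hom_A(Q, -)`, for an `(A, B)`-bimodule
`Q` which is finitely generated projective on both sides. -/
theorem dominantDimension_le_of_bimodule {A : Type u} {B : Type v} {Q : Type w} [Ring A] [Ring B]
    [AddCommGroup Q] [Module A Q] (ρ : Bᵐᵒᵖ →+* Module.End A Q)
    [Module.Finite A Q] [Module.Projective A Q] {n : ℕ} (x : Fin n → Q) (f : Fin n → Q →+ B)
    (hf : ∀ i b q, f i (ρ (op b) q) = f i q * b) (hx : ∀ q, ∑ i, ρ (op (f i q)) (x i) = q)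
    [Module.Projective B (TwistedHom ρ A)] {m : ℕ} (g : (Fin m → TwistedHom ρ A) →ₗ[B] B)
    (hg : Function.Surjective g) : dominantDimension A ≤ dominantDimension B := by
  refine le_sInf ?_
  rintro _ ⟨C', N, hN, rfl⟩
  -- The infimum runs over all minimal coresolutions, so for `A` any single one suffices, while `C'`
  -- over `B` is arbitrary.
  let C := InjectiveHull.minimalCoresolution A A
  refine sInf_le ⟨C, N, fun hp => hN ?_, rfl⟩
  obtain ⟨i, hi⟩ := Module.projective_lifting_property g LinearMap.id hg
  obtain ⟨a, b, hab⟩ := C'.exists_retract (fun n => Fin m → TwistedHom ρ (C.I n))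
    (fun n => Module.Baer.pi fun _ =>
      TwistedHom.baer ρ x f hf hx (Module.Baer.of_injective (C.injective n)))
    ((TwistedHom.map ρ C.ε).compLeft (Fin m)) (fun n => (TwistedHom.map ρ (C.d n)).compLeft (Fin m))
    (TwistedHom.map_injective ρ C.ε_injective).comp_left
    (LinearMap.exact_compLeft (TwistedHom.map_exact ρ C.exact_zero) _)
    (fun n => LinearMap.exact_compLeft (TwistedHom.map_exact ρ (C.exact_succ n)) _)
    i g (DFunLike.congr_fun hi) N
  have : Module.Projective B (TwistedHom ρ (C.I N)) := TwistedHom.projective ρ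
  have := Module.Projective.pi_of_finite B (Fin m) (TwistedHom ρ (C.I N))
  exact Module.Projective.of_split a b (LinearMap.ext hab)

/-! ### Comparison of an endomorphism ring with a second ring -/

/-- Precomposition with the action of a ring `B` on `W`, as a right action of `B` on `Hom_Λ(W, U)`
commuting with the left action of `End_Λ(U)`. -/
def precompAction {Λ U W B : Type*} [Ring Λ] [Ring B] [AddCommGroup U] [Module Λ U]
    [AddCommGroup W] [Module Λ W] (ρ : B →+* Module.End Λ W) :
    Bᵐᵒᵖ →+* Module.End (Module.End Λ U) (W →ₗ[Λ] U) where
  toFun b :=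
    { toFun := fun q => q ∘ₗ ρ b.unop
      map_add' := fun _ _ => rfl
      map_smul' := fun _ _ => rfl }
  map_one' := LinearMap.ext fun q => by
    change q ∘ₗ ρ 1 = q
    rw [map_one]
    rfl
  map_mul' b c := LinearMap.ext fun q => by
    change q ∘ₗ ρ (c.unop * b.unop) = (q ∘ₗ ρ c.unop) ∘ₗ ρ b.unop
    rw [map_mul]
    rfl
  map_zero' := LinearMap.ext fun q => by
    change q ∘ₗ ρ 0 = 0
    rw [map_zero]
    exact LinearMap.comp_zero q
  map_add' b c := LinearMap.ext fun q => by
    change q ∘ₗ ρ (b.unop + c.unop) = q ∘ₗ ρ b.unop + q ∘ₗ ρ c.unop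
    rw [map_add]
    exact LinearMap.comp_add _ _ _

/-- The hypotheses unfold the conditions on `Q = Hom_Λ(W, U)`: `α, β` say that `W ∈ add U`; `x, f`
are a dual basis of `Q` over `B` on the right; `y, φ` are one of `Hom_Λ(U, W)` over `B` on the left;
`s, ψ` make `B` a quotient of a power of `Hom_Λ(U, W)`. -/
theorem dominantDimension_end_le {Λ : Type*} {U : Type u} {W : Type*} {B : Type v} [Ring Λ]
    [Ring B] [AddCommGroup U] [Module Λ U] [AddCommGroup W] [Module Λ W]
    (ρ : B →+* Module.End Λ W) {n : ℕ} (α : Fin n → W →ₗ[Λ] U) (β : Fin n → U →ₗ[Λ] W)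
    (hβα : ∑ i, β i ∘ₗ α i = LinearMap.id)
    {n₁ : ℕ} (x : Fin n₁ → W →ₗ[Λ] U) (f : Fin n₁ → (W →ₗ[Λ] U) →+ B)
    (hf : ∀ i b q, f i (q ∘ₗ ρ b) = f i q * b) (hx : ∀ q, ∑ i, x i ∘ₗ ρ (f i q) = q)
    {n₂ : ℕ} (y : Fin n₂ → U →ₗ[Λ] W) (φ : Fin n₂ → (U →ₗ[Λ] W) →+ B)
    (hφ : ∀ i b s, φ i (ρ b ∘ₗ s) = b * φ i s) (hy : ∀ s, ∑ i, ρ (φ i s) ∘ₗ y i = s)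
    {n₃ : ℕ} (s : Fin n₃ → U →ₗ[Λ] W) (ψ : Fin n₃ → (U →ₗ[Λ] W) →+ B)
    (hψ : ∀ i b s, ψ i (ρ b ∘ₗ s) = b * ψ i s) (hs : ∑ i, ψ i (s i) = 1) :
    dominantDimension (Module.End Λ U) ≤ dominantDimension B := by
  let A := Module.End Λ U
  let ρ' : Bᵐᵒᵖ →+* Module.End A (W →ₗ[Λ] U) := precompAction ρ
  have hβα' : ∀ w, ∑ i, β i (α i w) = w := fun w => by
    simpa using DFunLike.congr_fun hβα w
  let toCoord : (W →ₗ[Λ] U) →ₗ[A] (Fin n → A) :=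
    { toFun := fun q i => q ∘ₗ β i
      map_add' := fun _ _ => rfl
      map_smul' := fun _ _ => rfl }
  let ofCoord : (Fin n → A) →ₗ[A] (W →ₗ[Λ] U) := Fintype.linearCombination A α
  have hcoord : ∀ q, ofCoord (toCoord q) = q := fun q => LinearMap.ext fun w => by
    simp only [ofCoord, Fintype.linearCombination_apply, LinearMap.sum_apply]
    change ∑ i, q (β i (α i w)) = q w
    rw [← map_sum, hβα']
  have : Module.Projective A (W →ₗ[Λ] U) :=
    Module.Projective.of_split toCoord ofCoord (LinearMap.ext hcoord)
  have : Module.Finite A (W →ₗ[Λ] U) :=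
    Module.Finite.of_surjective ofCoord fun q => ⟨_, hcoord q⟩
  let L := TwistedHom ρ' A
  -- `Hom_A(Q, A) ≅ Hom_Λ(U, W)`: a map `s` acts by `q ↦ q ∘ s`, and is recovered from its values at
  -- the generators `α i`.
  let toHom : L →+ (U →ₗ[Λ] W) :=
    { toFun := fun l => ∑ i, β i ∘ₗ (l (α i) : U →ₗ[Λ] U)
      map_zero' := Finset.sum_eq_zero fun i _ => LinearMap.comp_zero _
      map_add' := fun l l' => by
        rw [← Finset.sum_add_distrib]
        exact Finset.sum_congr rfl fun i _ => LinearMap.comp_add _ _ _ }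
  let ofHom : (U →ₗ[Λ] W) → L := fun s => TwistedHom.of ρ'
    { toFun := fun q => q ∘ₗ s
      map_add' := fun _ _ => rfl
      map_smul' := fun _ _ => rfl }
  have hto : ∀ s, toHom (ofHom s) = s := fun s => LinearMap.ext fun u => by
    change (∑ i, β i ∘ₗ (α i ∘ₗ s)) u = s u
    rw [LinearMap.sum_apply]
    exact hβα' (s u)
  have hof : ∀ l, ofHom (toHom l) = l := fun l => TwistedHom.ext fun q => by
    conv_rhs => rw [← hcoord q]
    simp only [ofCoord, Fintype.linearCombination_apply, map_sum, map_smul]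
    refine LinearMap.ext fun u => ?_
    change q ((∑ i, β i ∘ₗ (l (α i) : U →ₗ[Λ] U)) u) = _
    rw [LinearMap.sum_apply, LinearMap.sum_apply, map_sum]
    rfl
  have hofsmul : ∀ (b : B) s, ofHom (ρ b ∘ₗ s) = b • ofHom s := fun b s => rfl
  have htosmul : ∀ (b : B) l, toHom (b • l) = ρ b ∘ₗ toHom l := fun b l => by
    rw [← hto (ρ b ∘ₗ _), hofsmul, hof]
  let i : L →ₗ[B] (Fin n₂ → B) :=
    { toFun := fun l j => φ j (toHom l)
      map_add' := fun l l' => funext fun j => by simp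
      map_smul' := fun b l => funext fun j => by simp [htosmul, hφ] }
  have : Module.Projective B L :=
    Module.Projective.of_split i (Fintype.linearCombination B fun j => ofHom (y j))
      (LinearMap.ext fun l => by
        rw [LinearMap.comp_apply, Fintype.linearCombination_apply, LinearMap.id_apply]
        simp only [← hofsmul]
        rw [← hof (∑ j, _), map_sum]
        simp only [hto]
        exact (congrArg ofHom (hy _)).trans (hof l))
  let g : (Fin n₃ → L) →ₗ[B] B :=
    { toFun := fun l => ∑ j, ψ j (toHom (l j))
      map_add' := fun l l' => by simp [Finset.sum_add_distrib]
      map_smul' := fun b l => by simp [htosmul, hψ, Finset.mul_sum] }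
  have hg : g (fun j => ofHom (s j)) = 1 := by
    change ∑ j, ψ j (toHom (ofHom (s j))) = 1
    simp only [hto, hs]
  exact dominantDimension_le_of_bimodule ρ' x f hf hx g fun b =>
    ⟨b • fun j => ofHom (s j), by rw [map_smul, hg, smul_eq_mul, mul_one]⟩

/-! ### Biadjoint pairs of bimodules -/

theorem LinearMap.finset_sum_comp {R X Y Z ι : Type*} [Ring R] [AddCommGroup X] [Module R X]
    [AddCommGroup Y] [Module R Y] [AddCommGroup Z] [Module R Z] (s : Finset ι)
    (f : ι → Y →ₗ[R] Z) (g : X →ₗ[R] Y) : (∑ i ∈ s, f i) ∘ₗ g = ∑ i ∈ s, f i ∘ₗ g :=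
  map_sum (AddMonoidHom.mk' (fun f : Y →ₗ[R] Z => f ∘ₗ g) fun _ _ => rfl) f s

theorem LinearMap.comp_finset_sum {R X Y Z ι : Type*} [Ring R] [AddCommGroup X] [Module R X]
    [AddCommGroup Y] [Module R Y] [AddCommGroup Z] [Module R Z] (s : Finset ι)
    (f : Y →ₗ[R] Z) (g : ι → X →ₗ[R] Y) : f ∘ₗ (∑ i ∈ s, g i) = ∑ i ∈ s, f ∘ₗ g i :=
  map_sum (AddMonoidHom.mk' (fun g : X →ₗ[R] Y => f ∘ₗ g) fun g g' => LinearMap.comp_add g g' f) g s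

/-! ### The functor `M ⊗_Γ -` -/

namespace BalancedTensor

variable {Λ Γ M V V' V'' : Type*} [Ring Λ] [Ring Γ] [AddCommGroup M] [Module Λ M] [Module Γᵐᵒᵖ M]
  [SMulCommClass Λ Γᵐᵒᵖ M] [AddCommGroup V] [Module Γ V] [AddCommGroup V'] [Module Γ V']
  [AddCommGroup V''] [Module Γ V'']

theorem linearMap_ext {P : Type*} [AddCommGroup P] [Module Λ P]
    {f g : BalancedTensor Γ M V →ₗ[Λ] P} (h : ∀ m v, f (tmul Γ m v) = g (tmul Γ m v)) : f = g :=
  LinearMap.toAddMonoidHom_injective (hom_ext h)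

theorem tmul_sum {ι : Type*} (s : Finset ι) (m : M) (v : ι → V) :
    tmul Γ m (∑ i ∈ s, v i) = ∑ i ∈ s, tmul Γ m (v i) :=
  map_sum (AddMonoidHom.mk' (tmul Γ m) (tmul_add m)) v s

theorem sum_tmul {ι : Type*} (s : Finset ι) (m : ι → M) (v : V) :
    tmul Γ (∑ i ∈ s, m i) v = ∑ i ∈ s, tmul Γ (m i) v :=
  map_sum (AddMonoidHom.mk' (tmul Γ · v) fun m m' => add_tmul m m' v) m s

/-- A `Λ`-linear map out of `M ⊗_Γ V`. -/
def linearLift {P : Type*} [AddCommGroup P] [Module Λ P] (f : M →+ V →+ P)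
    (hf : ∀ (m : M) (g : Γ) (v : V), f (op g • m) v = f m (g • v))
    (hl : ∀ (a : Λ) m v, f (a • m) v = a • f m v) : BalancedTensor Γ M V →ₗ[Λ] P where
  toFun := lift f hf
  map_add' := map_add _
  map_smul' a t := by
    induction t using induction_on with
    | zero => simp
    | tmul m v => exact hl a m v
    | add x y hx hy => rw [smul_add, map_add, hx, hy, map_add, smul_add]

variable (Λ M)

/-- The functor `M ⊗_Γ -` on morphisms. -/
def mapRight (b : V →ₗ[Γ] V') : BalancedTensor Γ M V →ₗ[Λ] BalancedTensor Γ M V' where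
  toFun := map LinearMap.id b
  map_add' := map_add _
  map_smul' a t := by
    induction t using induction_on with
    | zero => simp
    | tmul m v => rfl
    | add x y hx hy => rw [smul_add, map_add, hx, hy, map_add, smul_add]

@[simp] theorem mapRight_tmul (b : V →ₗ[Γ] V') (m : M) (v : V) :
    mapRight Λ M b (tmul Γ m v) = tmul Γ m (b v) := rfl

theorem mapRight_id : mapRight Λ M (LinearMap.id : V →ₗ[Γ] V) = LinearMap.id :=
  linearMap_ext fun _ _ => rfl

theorem mapRight_comp (c : V' →ₗ[Γ] V'') (b : V →ₗ[Γ] V') :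
    mapRight Λ M (c ∘ₗ b) = mapRight Λ M c ∘ₗ mapRight Λ M b :=
  linearMap_ext fun _ _ => rfl

theorem mapRight_add (b c : V →ₗ[Γ] V') :
    mapRight Λ M (b + c) = mapRight Λ M b + mapRight Λ M c :=
  linearMap_ext fun m v => tmul_add m (b v) (c v)

theorem mapRight_zero : mapRight Λ M (0 : V →ₗ[Γ] V') = 0 :=
  linearMap_ext fun m _ => tmul_zero m

theorem mapRight_sum {ι : Type*} (s : Finset ι) (b : ι → V →ₗ[Γ] V') :
    mapRight Λ M (∑ i ∈ s, b i) = ∑ i ∈ s, mapRight Λ M (b i) :=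
  map_sum (AddMonoidHom.mk' (mapRight Λ M) (mapRight_add Λ M)) b s

variable (V) in
/-- The ring homomorphism `End_Γ(V) → End_Λ(M ⊗_Γ V)`. -/
def mapEnd : Module.End Γ V →+* Module.End Λ (BalancedTensor Γ M V) where
  toFun b := mapRight Λ M b
  map_one' := mapRight_id Λ M
  map_mul' := mapRight_comp Λ M
  map_zero' := mapRight_zero Λ M
  map_add' := mapRight_add Λ M

end BalancedTensor

open BalancedTensor

/-- A `(Λ, Γ)`-bimodule `M` and a `(Γ, Λ)`-bimodule `M'` with bimodule maps `M ⊗_Γ M' → Λ` and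
`M' ⊗_Λ M → Γ` for which `M` and `M'` have dual bases on both sides, so that the functors `M ⊗_Γ -`
and `M' ⊗_Λ -` are adjoint on both sides. -/
structure BiadjointPair (Λ Γ M M' : Type*) [Ring Λ] [Ring Γ]
    [AddCommGroup M] [Module Λ M] [Module Γᵐᵒᵖ M]
    [AddCommGroup M'] [Module Γ M'] [Module Λᵐᵒᵖ M'] where
  p : M →+ M' →+ Λ
  r : M' →+ M →+ Γ
  p_smul_left : ∀ (a : Λ) m f, p (a • m) f = a * p m f
  p_smul_right : ∀ (a : Λ) m f, p m (op a • f) = p m f * a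
  p_balanced : ∀ (g : Γ) m f, p (op g • m) f = p m (g • f)
  r_smul_left : ∀ (g : Γ) f m, r (g • f) m = g * r f m
  r_smul_right : ∀ (g : Γ) f m, r f (op g • m) = r f m * g
  r_balanced : ∀ (a : Λ) f m, r (op a • f) m = r f (a • m)
  n : ℕ
  b : Fin n → M
  b' : Fin n → M'
  sum_p_smul : ∀ m, ∑ i, p m (b' i) • b i = m
  sum_op_p_smul : ∀ f, ∑ i, op (p (b i) f) • b' i = f
  l : ℕ
  c : Fin l → M
  c' : Fin l → M'
  sum_r_smul : ∀ f, ∑ i, r f (c i) • c' i = f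
  sum_op_r_smul : ∀ m, ∑ i, op (r (c' i) m) • c i = m

theorem IsInAdd.exists_sum_comp_eq_id {R W U : Type*} [Ring R] [AddCommGroup W] [Module R W]
    [AddCommGroup U] [Module R U] (h : IsInAdd R W U) :
    ∃ (n : ℕ) (α : Fin n → W →ₗ[R] U) (β : Fin n → U →ₗ[R] W),
      ∑ i, β i ∘ₗ α i = LinearMap.id := by
  obtain ⟨n, W', _, _, ⟨e⟩⟩ := h
  refine ⟨n, fun i => LinearMap.proj i ∘ₗ e.toLinearMap ∘ₗ LinearMap.inl R W W',
    fun i => LinearMap.fst R W W' ∘ₗ e.symm.toLinearMap ∘ₗ LinearMap.single R (fun _ => U) i,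
    LinearMap.ext fun w => ?_⟩
  rw [LinearMap.sum_apply]
  change ∑ i, (LinearMap.fst R W W' ∘ₗ e.symm.toLinearMap) (Pi.single i (e (w, 0) i)) = w
  rw [← map_sum, Finset.univ_sum_single]
  simp

namespace BiadjointPair

variable {Λ Γ M M' : Type*} [Ring Λ] [Ring Γ]
  [AddCommGroup M] [Module Λ M] [Module Γᵐᵒᵖ M]
  [AddCommGroup M'] [Module Γ M'] [Module Λᵐᵒᵖ M']

/-- Exchange of the two bimodules. -/
def symm (D : BiadjointPair Λ Γ M M') : BiadjointPair Γ Λ M' M where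
  p := D.r
  r := D.p
  p_smul_left := D.r_smul_left
  p_smul_right := D.r_smul_right
  p_balanced := D.r_balanced
  r_smul_left := D.p_smul_left
  r_smul_right := D.p_smul_right
  r_balanced := D.p_balanced
  n := D.l
  b := D.c'
  b' := D.c
  sum_p_smul := D.sum_r_smul
  sum_op_p_smul := D.sum_op_r_smul
  l := D.n
  c := D.b'
  c' := D.b
  sum_r_smul := D.sum_p_smul
  sum_op_r_smul := D.sum_op_p_smul

variable (D : BiadjointPair Λ Γ M M')

/-- The map `M' ⊗_Λ U → U`, `f ⊗ u ↦ p(m, f) * u`. -/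
def contract (U : Type*) [AddCommGroup U] [Module Λ U] (m : M) : BalancedTensor Λ M' U →+ U :=
  lift ((AddMonoidHom.smul (M := U)).comp (D.p m)) fun f a u => by
    change D.p m (op a • f) • u = D.p m f • a • u
    rw [D.p_smul_right, mul_smul]

theorem contract_tmul {U : Type*} [AddCommGroup U] [Module Λ U] (m : M) (f : M') (u : U) :
    D.contract U m (tmul Λ f u) = D.p m f • u := rfl

variable [SMulCommClass Λ Γᵐᵒᵖ M] [SMulCommClass Γ Λᵐᵒᵖ M']

/-- The counit `M ⊗_Γ (M' ⊗_Λ U) → U`. -/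
def counit (U : Type*) [AddCommGroup U] [Module Λ U] :
    BalancedTensor Γ M (BalancedTensor Λ M' U) →ₗ[Λ] U :=
  linearLift
    (AddMonoidHom.mk' (D.contract U) fun m m' => hom_ext fun f u => by
      rw [AddMonoidHom.add_apply, contract_tmul, contract_tmul, contract_tmul, map_add,
        AddMonoidHom.add_apply, add_smul])
    (fun m g t => by
      change D.contract U (op g • m) t = D.contract U m (g • t)
      induction t using induction_on with
      | zero => simp
      | tmul f u => rw [left_smul_tmul, contract_tmul, contract_tmul, D.p_balanced]
      | add x y hx hy => rw [smul_add, map_add, map_add, hx, hy])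
    (fun a m t => by
      change D.contract U (a • m) t = a • D.contract U m t
      induction t using induction_on with
      | zero => simp
      | tmul f u => rw [contract_tmul, contract_tmul, D.p_smul_left, mul_smul]
      | add x y hx hy => rw [map_add, map_add, hx, hy, smul_add])

@[simp] theorem counit_tmul {U : Type*} [AddCommGroup U] [Module Λ U] (m : M) (f : M') (u : U) :
    D.counit U (tmul Γ m (tmul Λ f u)) = D.p m f • u := rfl

theorem counit_naturality {U U' : Type*} [AddCommGroup U] [Module Λ U] [AddCommGroup U']
    [Module Λ U'] (q : U →ₗ[Λ] U') :
    D.counit U' ∘ₗ mapRight Λ M (mapRight Γ M' q) = q ∘ₗ D.counit U :=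
  linearMap_ext fun m t => by
    induction t using induction_on with
    | zero => simp [BalancedTensor.tmul_zero]
    | tmul f u => simp
    | add x y hx hy => rw [tmul_add, map_add, map_add, hx, hy]

/-- The unit `V → M' ⊗_Λ (M ⊗_Γ V)`. -/
def unit (V : Type*) [AddCommGroup V] [Module Γ V] :
    V →ₗ[Γ] BalancedTensor Λ M' (BalancedTensor Γ M V) where
  toFun v := ∑ i, tmul Λ (D.b' i) (tmul Γ (D.b i) v)
  map_add' v v' := by simp only [tmul_add, Finset.sum_add_distrib]
  map_smul' g v := by
    -- `∑ b'_i ⊗ b_i` commutes with `Γ`: expand `b_i g` in the basis `b`, move the coefficients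
    -- across `⊗_Λ`, and recombine them into `g b'_j`.
    have h1 : ∀ i, tmul Λ (D.b' i) (tmul Γ (D.b i) (g • v)) =
        ∑ j, tmul Λ (op (D.p (D.b i) (g • D.b' j)) • D.b' i) (tmul Γ (D.b j) v) := fun i => by
      rw [← BalancedTensor.smul_tmul, ← D.sum_p_smul (op g • D.b i), sum_tmul, tmul_sum]
      refine Finset.sum_congr rfl fun j _ => ?_
      rw [D.p_balanced, BalancedTensor.smul_tmul, left_smul_tmul]
    simp only [h1]
    rw [Finset.sum_comm, RingHom.id_apply, Finset.smul_sum]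
    refine Finset.sum_congr rfl fun j _ => ?_
    rw [← sum_tmul, D.sum_op_p_smul, left_smul_tmul]

theorem unit_apply {V : Type*} [AddCommGroup V] [Module Γ V] (v : V) :
    D.unit V v = ∑ i, tmul Λ (D.b' i) (tmul Γ (D.b i) v) := rfl

theorem unit_naturality {V V' : Type*} [AddCommGroup V] [Module Γ V] [AddCommGroup V']
    [Module Γ V'] (b : V →ₗ[Γ] V') :
    mapRight Γ M' (mapRight Λ M b) ∘ₗ D.unit V = D.unit V' ∘ₗ b :=
  LinearMap.ext fun v => by simp [unit_apply]

/-- For the adjunction with `M ⊗ -` on the left: `q` is recovered from its transpose `V → M' ⊗ U`.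
-/
theorem counit_comp_mapRight_unit {U V : Type*} [AddCommGroup U] [Module Λ U] [AddCommGroup V]
    [Module Γ V] (q : BalancedTensor Γ M V →ₗ[Λ] U) :
    D.counit U ∘ₗ mapRight Λ M (mapRight Γ M' q ∘ₗ D.unit V) = q :=
  linearMap_ext fun m v => by
    conv_rhs => rw [← D.sum_p_smul m, sum_tmul, map_sum]
    simp [unit_apply, tmul_sum, ← left_smul_tmul]

/-- For the opposite adjunction, with `M' ⊗ -` on the left: `s` is recovered from its transpose `M'
⊗ U → V`. -/
theorem mapRight_counit_comp_unit {U V : Type*} [AddCommGroup U] [Module Λ U] [AddCommGroup V]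
    [Module Γ V] (s : U →ₗ[Λ] BalancedTensor Γ M V) :
    mapRight Λ M (D.symm.counit V ∘ₗ mapRight Γ M' s) ∘ₗ D.symm.unit U = s := by
  have key : ∀ t : BalancedTensor Γ M V,
      ∑ i, tmul Γ (D.c i) (D.symm.counit V (tmul Λ (D.c' i) t)) = t := fun t => by
    induction t using induction_on with
    | zero => simp [BalancedTensor.tmul_zero]
    | tmul m v =>
      conv_rhs => rw [← D.sum_op_r_smul m, sum_tmul]
      exact Finset.sum_congr rfl fun i _ => (BalancedTensor.smul_tmul _ _ _).symm
    | add x y hx hy =>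
      conv_rhs => rw [← hx, ← hy]
      simp only [tmul_add, map_add, Finset.sum_add_distrib]
  refine LinearMap.ext fun u => ?_
  conv_rhs => rw [← key (s u)]
  simp only [LinearMap.comp_apply, unit_apply, map_sum, mapRight_tmul]
  rfl

/-- Here `W = M ⊗_Γ V`. Transposing the maps `a, b` that exhibit `M' ⊗ U ∈ add V` gives both dual
bases over `End_Γ(V)`. The generator condition comes from `θ`, by factoring the identity of `M ⊗ V`
through `U` in `counit ∘ θ = id`. -/
theorem dominantDimension_le {U V : Type*} [AddCommGroup U] [Module Λ U] [AddCommGroup V]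
    [Module Γ V] (hU : IsInAdd Γ (BalancedTensor Λ M' U) V)
    (hV : IsInAdd Λ (BalancedTensor Γ M V) U)
    (θ : V →ₗ[Γ] BalancedTensor Λ M' (BalancedTensor Γ M V))
    (hθ : D.symm.counit V ∘ₗ θ = LinearMap.id) :
    dominantDimension (Module.End Λ U) ≤ dominantDimension (Module.End Γ V) := by
  obtain ⟨n, α, β, hβα⟩ := hV.exists_sum_comp_eq_id
  obtain ⟨l, a, b, hba⟩ := hU.exists_sum_comp_eq_id
  let sharp (s : U →ₗ[Λ] BalancedTensor Γ M V) : BalancedTensor Λ M' U →ₗ[Γ] V :=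
    D.symm.counit V ∘ₗ mapRight Γ M' s
  have sharp_add : ∀ s s', sharp (s + s') = sharp s + sharp s' := fun s s' => by
    simp only [sharp, mapRight_add, LinearMap.comp_add]
  have sharp_smul : ∀ (c : V →ₗ[Γ] V) s, sharp (mapRight Λ M c ∘ₗ s) = c ∘ₗ sharp s := fun c s => by
    simp only [sharp, mapRight_comp, ← LinearMap.comp_assoc]
    rw [D.symm.counit_naturality c]
  refine dominantDimension_end_le (mapEnd Λ M V) α β hβα
    (fun i => D.counit U ∘ₗ mapRight Λ M (b i))
    (fun i => AddMonoidHom.mk' (fun q => a i ∘ₗ mapRight Γ M' q ∘ₗ D.unit V) fun q q' => by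
      simp only [mapRight_add, LinearMap.comp_add, LinearMap.add_comp])
    (fun i c q => ?_) (fun q => ?_)
    (fun i => mapRight Λ M (a i) ∘ₗ D.symm.unit U)
    (fun i => AddMonoidHom.mk' (fun s => sharp s ∘ₗ b i) fun s s' => by
      simp only [sharp_add, LinearMap.add_comp])
    (fun i c s => ?_) (fun s => ?_) β
    (fun i => AddMonoidHom.mk' (fun s => sharp s ∘ₗ mapRight Γ M' (α i) ∘ₗ θ) fun s s' => by
      simp only [sharp_add, LinearMap.add_comp])
    (fun i c s => ?_) ?_
  · change a i ∘ₗ mapRight Γ M' (q ∘ₗ mapRight Λ M c) ∘ₗ D.unit V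
      = (a i ∘ₗ mapRight Γ M' q ∘ₗ D.unit V) ∘ₗ c
    rw [mapRight_comp, LinearMap.comp_assoc, D.unit_naturality c]
    rfl
  · change ∑ i, (D.counit U ∘ₗ mapRight Λ M (b i)) ∘ₗ
      mapRight Λ M (a i ∘ₗ mapRight Γ M' q ∘ₗ D.unit V) = q
    conv_rhs => rw [← D.counit_comp_mapRight_unit q,
      ← LinearMap.id_comp (mapRight Γ M' q ∘ₗ D.unit V), ← hba]
    simp only [LinearMap.finset_sum_comp, mapRight_sum, LinearMap.comp_finset_sum, mapRight_comp,
      LinearMap.comp_assoc]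
  · change sharp (mapRight Λ M c ∘ₗ s) ∘ₗ b i = c ∘ₗ sharp s ∘ₗ b i
    rw [sharp_smul, LinearMap.comp_assoc]
  · change ∑ i, mapRight Λ M (sharp s ∘ₗ b i) ∘ₗ mapRight Λ M (a i) ∘ₗ D.symm.unit U = s
    conv_rhs => rw [← D.mapRight_counit_comp_unit s,
      ← LinearMap.comp_id (D.symm.counit V ∘ₗ mapRight Γ M' s), ← hba]
    simp only [LinearMap.finset_sum_comp, mapRight_sum, LinearMap.comp_finset_sum, mapRight_comp,
      LinearMap.comp_assoc, sharp]
  · change sharp (mapRight Λ M c ∘ₗ s) ∘ₗ mapRight Γ M' (α i) ∘ₗ θ = c ∘ₗ sharp s ∘ₗ _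
    rw [sharp_smul, LinearMap.comp_assoc]
  · change ∑ i, sharp (β i) ∘ₗ mapRight Γ M' (α i) ∘ₗ θ = LinearMap.id
    conv_rhs => rw [← hθ, ← LinearMap.id_comp θ, ← mapRight_id, ← hβα]
    simp only [LinearMap.finset_sum_comp, mapRight_sum, LinearMap.comp_finset_sum, mapRight_comp,
      LinearMap.comp_assoc, sharp]

/-- If the pairing `M' ⊗_Λ M → Γ` takes the value `1` on the image of a `Γ`-central element under a
map of bimodules, then the counit `M' ⊗_Λ (M ⊗_Γ V) → V` is a split epimorphism. -/
theorem exists_section {P P' : Type*} [AddCommGroup P] [Module Γ P] [Module Λᵐᵒᵖ P]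
    [SMulCommClass Γ Λᵐᵒᵖ P] [AddCommGroup P'] [Module Λ P'] [Module Γᵐᵒᵖ P']
    [SMulCommClass Λ Γᵐᵒᵖ P'] (ν : P →ₗ[Γ] M') (hν : ∀ (a : Λ) n, ν (op a • n) = op a • ν n)
    (μ : P' →ₗ[Λ] M) (hμ : ∀ (g : Γ) m, μ (op g • m) = op g • μ m)
    (σ : BalancedTensor Λ P P' →+ Γ) (hσ : ∀ n m, D.r (ν n) (μ m) = σ (tmul Λ n m))
    (e : BalancedTensor Λ P P') (he : ∀ g : Γ, op g • e = g • e) (hσe : σ e = 1)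
    (V : Type*) [AddCommGroup V] [Module Γ V] :
    ∃ θ : V →ₗ[Γ] BalancedTensor Λ M' (BalancedTensor Γ M V),
      D.symm.counit V ∘ₗ θ = LinearMap.id := by
  -- The section is `v ↦ e v`, viewed in `M' ⊗ (M ⊗ V)` through `ν` and `μ`; centrality of `e` makes
  -- it `Γ`-linear, and `σ e = 1` makes it a section.
  let act : BalancedTensor Λ P P' →+ V →+ BalancedTensor Λ M' (BalancedTensor Γ M V) :=
    lift (AddMonoidHom.mk' (fun n => AddMonoidHom.mk' (fun m => AddMonoidHom.mk'
        (fun v => tmul Λ (ν n) (tmul Γ (μ m) v)) fun v v' => by simp only [tmul_add])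
        fun m m' => by ext v; simp [add_tmul, tmul_add])
        fun n n' => by ext m v; simp [add_tmul])
      fun n a m => by ext v; simp [hν, BalancedTensor.smul_tmul, left_smul_tmul]
  have act_tmul : ∀ n m v, act (tmul Λ n m) v = tmul Λ (ν n) (tmul Γ (μ m) v) := fun _ _ _ => rfl
  have act_left : ∀ (g : Γ) t v, act (g • t) v = g • act t v := fun g t v => by
    induction t using induction_on with
    | zero => simp
    | tmul n m => simp [act_tmul, left_smul_tmul]
    | add x y hx hy => simp [hx, hy]
  have act_right : ∀ (g : Γ) t v, act (op g • t) v = act t (g • v) := fun g t v => by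
    induction t using induction_on with
    | zero => simp
    | tmul n m => simp [act_tmul, right_smul_tmul, hμ, BalancedTensor.smul_tmul]
    | add x y hx hy => simp [hx, hy]
  have counit_act : ∀ t v, D.symm.counit V (act t v) = σ t • v := fun t v => by
    induction t using induction_on with
    | zero => simp
    | tmul n m =>
      rw [act_tmul, counit_tmul, ← hσ]
      rfl
    | add x y hx hy => simp [hx, hy, add_smul]
  refine ⟨{ toFun := act e, map_add' := map_add _, map_smul' := fun g v => ?_ },
    LinearMap.ext fun v => ?_⟩
  · rw [← act_right, he, act_left]
    rfl
  · change D.symm.counit V (act e v) = v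
    rw [counit_act, hσe, one_smul]

end BiadjointPair

/-- A bimodule map out of `Λ` is determined by a central element, the image of `1`; here `e`
corresponds to `(1, 0)`. -/
theorem SplitsOffRegularBimodule.exists_central {Λ T : Type*} [Ring Λ] [AddCommGroup T]
    [Module Λ T] [Module Λᵐᵒᵖ T] (h : SplitsOffRegularBimodule Λ T) :
    ∃ (σ : T →ₗ[Λ] Λ) (e : T), (∀ (a : Λ) t, σ (op a • t) = σ t * a) ∧ σ e = 1 ∧
      ∀ a : Λ, op a • e = a • e := by
  obtain ⟨X, _, _, _, _, φ, hφ⟩ := h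
  refine ⟨LinearMap.fst Λ Λ X ∘ₗ φ.toLinearMap, φ.symm (1, 0), fun a t => ?_, by simp, fun a => ?_⟩
  · simp [hφ]
  · refine φ.injective ?_
    rw [hφ, map_smul, φ.apply_symm_apply]
    ext <;> simp

/-! ### Bimodules over symmetric algebras -/

theorem Module.Projective.exists_dual_basis (R P : Type*) [Ring R] [AddCommGroup P] [Module R P]
    [Module.Finite R P] [Module.Projective R P] :
    ∃ (n : ℕ) (b : Fin n → P) (f : Fin n → P →ₗ[R] R), ∀ q, ∑ i, f i q • b i = q := by
  obtain ⟨n, f, g, -, -, h⟩ := Module.Finite.exists_comp_eq_id_of_projective R P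
  refine ⟨n, fun i => f (Pi.single i 1), fun i => LinearMap.proj i ∘ₗ g, fun q => ?_⟩
  conv_rhs => rw [← LinearMap.id_apply (R := R) q, ← h, LinearMap.comp_apply,
    ← Finset.univ_sum_single (g q), map_sum]
  refine Finset.sum_congr rfl fun i _ => ?_
  rw [LinearMap.comp_apply, LinearMap.proj_apply, ← map_smul, ← Pi.single_smul', smul_eq_mul,
    mul_one]

/-- The symmetrizing form is `t = e 1`: bilinearity of `e` over `Λ` gives `e x y = t (x y) = t (y
x)`. -/
theorem IsSymmetricFrobeniusAlgebra.exists_form {k Λ : Type*} [Field k] [Ring Λ] [Algebra k Λ]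
    (h : IsSymmetricFrobeniusAlgebra k Λ) :
    ∃ (t : Λ →ₗ[k] k) (rep : Module.Dual k Λ →+ Λ), (∀ x y, t (x * y) = t (y * x)) ∧
      (∀ x y, (∀ z, t (z * x) = t (z * y)) → x = y) ∧ ∀ φ y, t (y * rep φ) = φ y := by
  obtain ⟨-, e, he⟩ := h
  have h1 : ∀ x y, e x y = e 1 (y * x) := fun x y => by simpa using he x 1 1 y
  have h2 : ∀ x y, e x y = e 1 (x * y) := fun x y => by simpa using he 1 1 x y
  exact ⟨e 1, e.symm.toLinearMap.toAddMonoidHom, fun x y => by rw [← h2, h1],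
    fun x y hxy => e.injective (LinearMap.ext fun z => by rw [h1 x, h1 y, hxy]),
    fun φ y => by
      rw [← h1]
      exact DFunLike.congr_fun (e.apply_symm_apply φ) y⟩

instance BimoduleDual.instLinearMapClass (Λ : Type u) [Ring Λ] (M : Type v) [AddCommGroup M]
    [Module Λ M] : LinearMapClass (BimoduleDual Λ M) Λ M Λ :=
  inferInstanceAs (LinearMapClass (M →ₗ[Λ] Λ) Λ M Λ)

theorem BimoduleDual.ext {Λ : Type u} [Ring Λ] {M : Type v} [AddCommGroup M]
    [Module Λ M] {f f' : BimoduleDual Λ M} (h : ∀ m, f m = f' m) : f = f' := LinearMap.ext h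

section SymmetricAlgebra

variable {k : Type*} [Field k] {Λ : Type*} [Ring Λ] [Algebra k Λ] {Γ : Type*} [Ring Γ] [Algebra k Γ]
  {M : Type*} [AddCommGroup M] [Module Λ M] [Module Γᵐᵒᵖ M]

/-- Composition with `t` identifies `Hom_Λ(M, Λ)` with `Hom_k(M, k)`, so the functional `t' ∘ g`
comes from some `f`. -/
theorem exists_dual_of_right_linear
    (hM : ∀ (c : k) (m : M), algebraMap k Λ c • m = op (algebraMap k Γ c) • m)
    (t : Λ →ₗ[k] k) (rep : Module.Dual k Λ →+ Λ)
    (hnd : ∀ x y, (∀ z, t (z * x) = t (z * y)) → x = y) (hrep : ∀ φ y, t (y * rep φ) = φ y)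
    (t' : Γ →ₗ[k] k) (g : M →ₗ[Γᵐᵒᵖ] Γ) :
    ∃ f : BimoduleDual Λ M, ∀ a m, t (a * f m) = t' (g (a • m)) := by
  let φ (m : M) : Module.Dual k Λ :=
    { toFun := fun a => t' (g (a • m))
      map_add' := fun a a' => by rw [add_smul, map_add, map_add]
      -- Centrality of `k` enters here: the scalar passes to the right side, where `g` is linear.
      map_smul' := fun c a => by
        rw [Algebra.smul_def, mul_smul, hM, map_smul, op_smul_eq_mul, ← Algebra.commutes,
          ← Algebra.smul_def, map_smul, RingHom.id_apply] }
  have hφ : ∀ m a, t (a * rep (φ m)) = t' (g (a • m)) := fun m a => hrep _ _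
  refine ⟨({ toFun := fun m => rep (φ m), map_add' := fun m m' => ?_, map_smul' := fun a m => ?_ } :
    M →ₗ[Λ] Λ), fun a m => hφ m a⟩
  · refine hnd _ _ fun a => ?_
    rw [hφ, mul_add, map_add, hφ, hφ, smul_add, map_add, map_add]
  · refine hnd _ _ fun a' => ?_
    rw [hφ, RingHom.id_apply, smul_eq_mul, ← mul_assoc, hφ, mul_smul]

variable [SMulCommClass Λ Γᵐᵒᵖ M]

/-- The same identification on the `Γ` side: `r f` is the lift of the functional `t ∘ f` through
`t'`. -/
theorem exists_dual_pairing
    (hM : ∀ (c : k) (m : M), algebraMap k Λ c • m = op (algebraMap k Γ c) • m)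
    (t : Λ →ₗ[k] k) (t' : Γ →ₗ[k] k) (rep : Module.Dual k Γ →+ Γ)
    (hrep : ∀ φ y, t' (y * rep φ) = φ y) :
    ∃ r : BimoduleDual Λ M →+ M →+ Γ, ∀ f m g, t' (g * r f m) = t (f (op g • m)) := by
  let φ (f : BimoduleDual Λ M) (m : M) : Module.Dual k Γ :=
    { toFun := fun g => t (f (op g • m))
      map_add' := fun g g' => by rw [op_add, add_smul, map_add, map_add]
      map_smul' := fun c g => by
        rw [Algebra.smul_def, op_mul, mul_smul, ← hM, ← smul_comm, map_smul, smul_eq_mul,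
          ← Algebra.smul_def, map_smul, RingHom.id_apply] }
  refine ⟨AddMonoidHom.mk' (fun f => AddMonoidHom.mk' (fun m => rep (φ f m)) fun m m' => ?_)
    fun f f' => ?_, fun f m g => hrep _ _⟩
  · rw [← map_add]
    congr 1
    refine LinearMap.ext fun g => ?_
    change t (f (op g • (m + m'))) = t (f (op g • m)) + t (f (op g • m'))
    rw [smul_add, map_add, map_add]
  · ext m
    change rep (φ (f + f') m) = rep (φ f m) + rep (φ f' m)
    rw [← map_add]
    congr 1
    exact LinearMap.ext fun g => map_add t _ _

/-- Over symmetric algebras, a bimodule which is finitely generated projective on both sides and its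
dual form a biadjoint pair, with the evaluation as one of the pairings; the other pairing identifies
the dual with the right linear maps to `Γ`. -/
theorem exists_biadjointPair (hΛ : IsSymmetricFrobeniusAlgebra k Λ)
    (hΓ : IsSymmetricFrobeniusAlgebra k Γ)
    (hM : ∀ (c : k) (m : M), algebraMap k Λ c • m = op (algebraMap k Γ c) • m)
    [Module.Finite Λ M] [Module.Projective Λ M] [Module.Finite Γᵐᵒᵖ M]
    [Module.Projective Γᵐᵒᵖ M] :
    ∃ D : BiadjointPair Λ Γ M (BimoduleDual Λ M), (∀ m f, D.p m f = f m) ∧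
      (∀ g : M →ₗ[Γᵐᵒᵖ] Γ, ∃ f, ∀ m, D.r f m = g m) ∧
      ∀ f f', (∀ m, D.r f m = D.r f' m) → f = f' := by
  obtain ⟨t, rep, ht, hnd, hrep⟩ := hΛ.exists_form
  obtain ⟨t', rep', ht', hnd', hrep'⟩ := hΓ.exists_form
  obtain ⟨r, hr⟩ := exists_dual_pairing hM t t' rep' hrep'
  have hinj : ∀ f f', (∀ m, r f m = r f' m) → f = f' := fun f f' h =>
    BimoduleDual.ext fun m => hnd _ _ fun a => by
      have h1 := congrArg (fun x => t' (1 * x)) (h (a • m))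
      simp only [hr, op_one, one_smul] at h1
      rwa [map_smul f, map_smul f'] at h1
  have hsurj : ∀ g : M →ₗ[Γᵐᵒᵖ] Γ, ∃ f, ∀ m, r f m = g m := fun g => by
    obtain ⟨f, hf⟩ := exists_dual_of_right_linear hM t rep hnd hrep t' g
    refine ⟨f, fun m => hnd' _ _ fun c => ?_⟩
    have := hf 1 (op c • m)
    rw [one_mul, one_smul, map_smul g, op_smul_eq_mul] at this
    rw [hr, this, ht']
  have r_left : ∀ (g : Γ) f m, r (g • f) m = g * r f m := fun g f m => hnd' _ _ fun c => by
    rw [hr, ← mul_assoc, hr, BimoduleDual.left_smul_apply, op_mul, mul_smul]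
  have r_right : ∀ (g : Γ) f m, r f (op g • m) = r f m * g := fun g f m => hnd' _ _ fun c => by
    rw [hr, ← mul_assoc, ht', ← mul_assoc, hr, op_mul, mul_smul]
  have r_bal : ∀ (a : Λ) f m, r (op a • f) m = r f (a • m) := fun a f m => hnd' _ _ fun c => by
    rw [hr, hr, BimoduleDual.right_smul_apply, ← smul_comm, map_smul f a, smul_eq_mul, ht]
  obtain ⟨n, b, b', hb⟩ := Module.Projective.exists_dual_basis Λ M
  obtain ⟨l, c, h, hc⟩ := Module.Projective.exists_dual_basis Γᵐᵒᵖ M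
  -- The coordinates of a right dual basis are right linear maps `M → Γ`, hence represented by
  -- elements of `M^*`.
  choose c' hc' using fun i => hsurj
    { toFun := fun m => (h i m).unop
      map_add' := fun m m' => by rw [map_add, unop_add]
      map_smul' := fun g m => by rw [map_smul]; rfl }
  have hc'' : ∀ m, ∑ i, op (r (c' i) m) • c i = m := fun m => by
    simp only [hc']
    exact hc m
  refine ⟨{
    p := AddMonoidHom.mk' (fun m => AddMonoidHom.mk' (fun f : BimoduleDual Λ M => f m)
      fun f f' => rfl) fun m m' => by ext f; exact map_add f m m'
    r := r
    p_smul_left := fun a m f => map_smul f a m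
    p_smul_right := fun a m f => rfl
    p_balanced := fun g m f => rfl
    r_smul_left := r_left
    r_smul_right := r_right
    r_balanced := r_bal
    n := n
    b := b
    b' := b'
    sum_p_smul := hb
    sum_op_p_smul := fun f => BimoduleDual.ext fun m => ?_
    l := l
    c := c
    c' := c'
    sum_r_smul := fun f => hinj _ _ fun m => ?_
    sum_op_r_smul := hc'' }, fun _ _ => rfl, hsurj, hinj⟩
  · conv_rhs => rw [← hb m, map_sum]
    refine (LinearMap.sum_apply Finset.univ
      (fun i => (op (f (b i)) • b' i : BimoduleDual Λ M)) m).trans ?_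
    exact Finset.sum_congr rfl fun i _ => (map_smul f _ _).symm
  · conv_rhs => rw [← hc'' m, map_sum]
    rw [map_sum, AddMonoidHom.finsetSum_apply]
    exact Finset.sum_congr rfl fun i _ => by rw [r_left, r_right]

end SymmetricAlgebra

end

open BalancedTensor

theorem corollary3p9
    {k : Type*} [Field k]
    {Λ : Type*} [Ring Λ] [Algebra k Λ] (hΛ : IsSymmetricFrobeniusAlgebra k Λ)
    {Γ : Type*} [Ring Γ] [Algebra k Γ] (hΓ : IsSymmetricFrobeniusAlgebra k Γ)
    -- a bimodule over the `k`-algebras `Λ` and `Γ`, so `k` acts in the same way on both sides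
    {M : Type*} [AddCommGroup M] [Module Λ M] [Module Γᵐᵒᵖ M] [SMulCommClass Λ Γᵐᵒᵖ M]
    (hM : ∀ (c : k) (m : M), algebraMap k Λ c • m = MulOpposite.op (algebraMap k Γ c) • m)
    -- `M` induces a separable equivalence, together with some bimodule `N`
    {N : Type*} [AddCommGroup N] [Module Γ N] [Module Λᵐᵒᵖ N] [SMulCommClass Γ Λᵐᵒᵖ N]
    (hMN : IsSeparableEquivalence Λ Γ M N)
    {U : Type*} [AddCommGroup U] [Module Λ U] [Module.Finite Λ U]
    {V : Type*} [AddCommGroup V] [Module Γ V] [Module.Finite Γ V]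
    (hU : IsInAdd Γ (BalancedTensor Λ (BimoduleDual Λ M) U) V)
    (hV : IsInAdd Λ (BalancedTensor Γ M V) U) :
    dominantDimension (Module.End Λ U) = dominantDimension (Module.End Γ V) := by
  have := hMN.finite_M_left
  have := hMN.projective_M_left
  have := hMN.finite_M_right
  have := hMN.projective_M_right
  obtain ⟨D, hp, hsurj, hinj⟩ := exists_biadjointPair hΛ hΓ hM
  refine le_antisymm ?_ ?_
  · obtain ⟨σ, e, hσ, hσe, he⟩ := hMN.split_right.exists_central
    -- `σ(n ⊗ -)` is right `Γ`-linear, so it lies in `M^*` only after identifying `M^*` with the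
    -- right dual through `r`.
    choose ν hν using fun n : N => hsurj
      { toFun := fun m => σ (tmul Λ n m)
        map_add' := fun m m' => by rw [tmul_add, map_add]
        map_smul' := fun g m => hσ g.unop (tmul Λ n m) }
    replace hν : ∀ n m, D.r (ν n) m = σ (tmul Λ n m) := hν
    let ν' : N →ₗ[Γ] BimoduleDual Λ M :=
      { toFun := ν
        map_add' := fun n n' => hinj _ _ fun m => by
          rw [map_add, AddMonoidHom.add_apply, hν, hν, hν, add_tmul, map_add]
        map_smul' := fun g n => hinj _ _ fun m => by
          rw [RingHom.id_apply, D.r_smul_left, hν, hν, ← left_smul_tmul, map_smul, smul_eq_mul] }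
    obtain ⟨θ, hθ⟩ := D.exists_section ν'
      (fun a n => hinj _ _ fun m => by
        change D.r (ν (op a • n)) m = D.r (op a • ν n) m
        rw [D.r_balanced, hν, hν, BalancedTensor.smul_tmul])
      LinearMap.id (fun _ _ => rfl) σ.toAddMonoidHom hν e he hσe V
    exact D.dominantDimension_le hU hV θ hθ
  · obtain ⟨σ, e, hσ, hσe, he⟩ := hMN.split_left.exists_central
    -- On this side `σ(- ⊗ n)` is left `Λ`-linear and is itself an element of `M^*`, since `p` is
    -- evaluation.
    let μ (n : N) : M →ₗ[Λ] Λ :=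
      { toFun := fun m => σ (tmul Γ m n)
        map_add' := fun m m' => by rw [add_tmul, map_add]
        map_smul' := fun a m => map_smul σ a (tmul Γ m n) }
    let μ' : N →ₗ[Γ] BimoduleDual Λ M :=
      { toFun := μ
        map_add' := fun n n' => BimoduleDual.ext fun m =>
          (congrArg σ (tmul_add m n n')).trans (map_add σ _ _)
        map_smul' := fun g n => BimoduleDual.ext fun m =>
          congrArg σ (BalancedTensor.smul_tmul m g n).symm }
    obtain ⟨θ, hθ⟩ := D.symm.exists_section LinearMap.id (fun _ _ => rfl) μ'
      (fun a n => BimoduleDual.ext fun m => hσ a (tmul Γ m n)) σ.toAddMonoidHom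
      (fun m n => hp m (μ n)) e he hσe U
    exact D.symm.dominantDimension_le hV hU θ hθ
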